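/- **Setting.** Let $\lambda\in\mathbb R^d$, let $\Sigma\in\mathbb R^{d\times d}$ be symmetric positive definite, write $\phi(x;m,\Sigma)$ for the density of $N(m,\Sigma)$, and let $X$ have density $f=\phi(\cdot;\lambda,\Sigma)$ under $P$. Let $g:\mathbb R^d\to\mathbb R$ be piecewise linear: $\mathbb R^d$ is a finite union of closed polyhedra, on each of which $g$ agrees with an affine function. Put $\mathcal E=\mathcal E(\gamma)=\{x: g(x)\ge\gamma\}$, $p=p(\gamma)=P(X\in\mathcal E)$ and $q(x)=(x-\lambda)^T\Sigma^{-1}(x-\lambda)$. Let $C>1$ and $\gamma_0\in\mathbb R$, and assume that $P(X\in\mathcal E(\gamma))>0$ and $\lambda\notin\mathcal E(\gamma)$ for all $\gamma\ge\gamma_0$. **Search.** For each $\gamma\ge\gamma_0$ points $a_1,a_2,\dots$ are found one after the other: when $a_1,\dots,a_j$ have been found and the feasible set $F_j=\{x\in\mathcal E:(a_i-\lambda)^T\Sigma^{-1}(x-a_i)<0,\ i=1,\dots,j\}$ is non-empty, $a_{j+1}$ is a minimizer of $q$ over $F_j$. The search stops with $k=j$ if $F_j=\emptyset$, or if $j\ge1$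 and $q(a_{j+1})>Cq(a_j)$. (Ties may be broken arbitrarily; it is supposed that a minimizer exists at every step that this search reaches. Termination is not supposed.) **General notions.** $\mu(x)=\log E e^{x^TX}$, $I(y)=\sup_x\{x^Ty-\mu(x)\}$, and $s_y$ is the point of the interior of $\{\mu<\infty\}$ with $\nabla\mu(s_y)=y$ and $I(y)=s_y^Ty-\mu(s_y)$. A set $A\subset\mathcal E$ is dominating for $\mathcal E$ if every $x\in\mathcal E$ satisfies $s_a^T(x-a)\ge0$ for some $a\in A$, and no $A\setminus\{a\}$, $a\in A$, has this property. For non-negative functions of $\gamma$, "$\alpha\le\beta$ up to a subexponential factor" means that for every $\varepsilon>0$, $\alpha\le\beta e^{\varepsilon(-\log p)}$ for all large $\gamma$; $\alpha\sim\beta$ means this in both directions; $\alpha$ grows at most subexponentially if this holds with $\beta=1$; and $\alpha$ decays exponentially if $\alpha\le e^{-c(-\log p)}$ for some $c>0$ and all large $\gamma$. **Theorem.** For every $\gamma\ge\gamma_0$ the search stops, with some $k=k(\gamma)\ge1$, and there is a finite dominating set $A=\{a_1,\dots,a_r\}$ for $\mathcal E$, $r=r(\gamma)\ge k$, consisting of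 $r$ distinct points listed with $I(a_1)\le\dots\le I(a_r)$, whose first $k$ points (first $k+1$ points if $k<r$) are those found by the search; if the search can be continued without the stopping rule, every minimum being attained until the feasible set is empty, then $A$ is the set of all points found in this way. Let $$\tilde f(x)=\frac1k\sum_{i=1}^k\phi(x;a_i,\Sigma),\qquad \mathcal E_1=\mathcal E\cap\bigcup_{i=1}^k\{x:(a_i-\lambda)^T\Sigma^{-1}(x-a_i)\ge0\},\qquad \mathcal E_2=\mathcal E\setminus\mathcal E_1 ;$$ these are the general objects $\tilde f(x)=f(x)\sum_{i=1}^k\frac1k e^{s_{a_i}^Tx-\mu(s_{a_i})}$ and $\mathcal E_1=\mathcal E\cap\bigcup_{i\le k}\{x:s_{a_i}^T(x-a_i)\ge0\}$. Let $\tilde P$ be the law with density $\tilde f$. Then all of the following hold. 1. $f$ is a probability density and every $\mathcal E(\gamma)$ is closed; $p\to0$ as $\gamma\to\infty$; $\mu$ is a closed proper convex function, $0$ lies in the interior of its domain, $\mu$ is strictly convex and differentiable in that interior, and $\|\nabla\mu(x_n)\|\to\infty$ whenever points $x_n$ of that interior converge to a boundary point of the domain; $0<\inf_{\mathcal E(\gamma)}I<\infty$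 for all $\gamma\ge\gamma_0$; and $r$ grows at most subexponentially. 2. With $I(a_{k+1}):=\infty$ if $k=r$: $p_1:=P(X\in\mathcal E_1)\sim e^{-I(a_1)}$; $p_2:=P(X\in\mathcal E_2)\le e^{-I(a_{k+1})}$ up to a subexponential factor; and $e^{I(a_1)-I(a_{k+1})}$ decays exponentially. 3. $\tilde p_2:=\tilde P(X\in\mathcal E_2)$ decays exponentially. 4. For $Z_1=1_{\mathcal E_1}(X)\frac{f(X)}{\tilde f(X)}$ with $X\sim\tilde P$: $e^{-2I(a_1)}/\widetilde{\mathrm{Var}}(Z_1)$ grows at most subexponentially (in particular $\widetilde{\mathrm{Var}}(Z_1)>0$ for large $\gamma$). -/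

import Mathlib

open Set Filter Topology MeasureTheory ProbabilityTheory
open scoped ENNReal

noncomputable section

namespace RareEvent

/-! ### Piecewise linear functions and rare-event sets -/

/-- A closed convex polyhedron: the solution set of finitely many weak affine inequalities. -/
def IsClosedPolyhedron {d : ℕ} (D : Set (EuclideanSpace ℝ (Fin d))) : Prop :=
  ∃ (n : ℕ) (c : Fin n → EuclideanSpace ℝ (Fin d)) (β : Fin n → ℝ),
    D = {x | ∀ i, inner ℝ (c i) x ≤ β i}

/-- `g` is piecewise linear: the space is a finite union of closed polyhedra, and `g` agrees on
each of them with an affine function. -/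
def IsPiecewiseLinear {d : ℕ} (g : EuclideanSpace ℝ (Fin d) → ℝ) : Prop :=
  ∃ (m : ℕ) (D : Fin m → Set (EuclideanSpace ℝ (Fin d))),
    (∀ j, IsClosedPolyhedron (D j)) ∧ (⋃ j, D j) = univ ∧
    ∀ j, ∃ (u : EuclideanSpace ℝ (Fin d)) (v : ℝ), ∀ x ∈ D j, g x = inner ℝ u x + v

/-- The rare-event set `{x | g x ≥ γ}`. -/
def rareSet {d : ℕ} (g : EuclideanSpace ℝ (Fin d) → ℝ) (γ : ℝ) :
    Set (EuclideanSpace ℝ (Fin d)) :=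
  {x | γ ≤ g x}

/-- The distribution with Lebesgue density `f`. -/
def lawOf {d : ℕ} (f : EuclideanSpace ℝ (Fin d) → ℝ) : Measure (EuclideanSpace ℝ (Fin d)) :=
  volume.withDensity fun x => ENNReal.ofReal (f x)

/-! ### Cumulant generating function, rate function, dominating sets -/

/-- The cumulant generating function `μ(x) = log E exp(xᵀX)`, with values in `[-∞, ∞]`. -/
def cumulant {d : ℕ} (P : Measure (EuclideanSpace ℝ (Fin d))) (x : EuclideanSpace ℝ (Fin d)) :
    EReal :=
  ENNReal.log (∫⁻ y, ENNReal.ofReal (Real.exp (inner ℝ x y)) ∂P)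

/-- The rate function `I(y) = sup_x (xᵀy - μ(x))`. -/
def rate {d : ℕ} (P : Measure (EuclideanSpace ℝ (Fin d))) (y : EuclideanSpace ℝ (Fin d)) :
    EReal :=
  ⨆ x : EuclideanSpace ℝ (Fin d), (((inner ℝ x y : ℝ) : EReal) - cumulant P x)

/-- The effective domain `{x | h x < ∞}`. -/
def effDomain {d : ℕ} (h : EuclideanSpace ℝ (Fin d) → EReal) : Set (EuclideanSpace ℝ (Fin d)) :=
  {x | h x < ⊤}

/-- The real-valued version of the cumulant generating function, meaningful on its domain. -/
def cumulantReal {d : ℕ} (P : Measure (EuclideanSpace ℝ (Fin d)))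
    (x : EuclideanSpace ℝ (Fin d)) : ℝ :=
  (cumulant P x).toReal

/-- Basic assumption on the cumulant generating function: it is closed, proper and convex, `0` is
interior to its domain, it is strictly convex and differentiable on the interior of the domain, and
it is steep. -/
structure CumulantAssumption {d : ℕ} (P : Measure (EuclideanSpace ℝ (Fin d))) : Prop where
  closed : LowerSemicontinuous (cumulant P)
  proper : (∀ x, cumulant P x ≠ ⊥) ∧ ∃ x, cumulant P x ≠ ⊤
  convex : Convex ℝ {z : EuclideanSpace ℝ (Fin d) × ℝ | cumulant P z.1 ≤ (z.2 : EReal)}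
  zero_mem : 0 ∈ interior (effDomain (cumulant P))
  strictConvex : StrictConvexOn ℝ (interior (effDomain (cumulant P))) (cumulantReal P)
  differentiable : DifferentiableOn ℝ (cumulantReal P) (interior (effDomain (cumulant P)))
  steep : ∀ (x : ℕ → EuclideanSpace ℝ (Fin d)) (y : EuclideanSpace ℝ (Fin d)),
    (∀ n, x n ∈ interior (effDomain (cumulant P))) → y ∈ frontier (effDomain (cumulant P)) →
    Tendsto x atTop (𝓝 y) → Tendsto (fun n => ‖gradient (cumulantReal P) (x n)‖) atTop atTop

/-- `s` is interior to the domain of `μ`, `∇μ(s) = y`, and `I(y) = sᵀy - μ(s)`. -/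
def IsTilt {d : ℕ} (P : Measure (EuclideanSpace ℝ (Fin d)))
    (y s : EuclideanSpace ℝ (Fin d)) : Prop :=
  s ∈ interior (effDomain (cumulant P)) ∧ HasGradientAt (cumulantReal P) y s ∧
    rate P y = ((inner ℝ s y : ℝ) : EReal) - cumulant P s

/-- The tilting vector `s_y`. -/
def tilt {d : ℕ} (P : Measure (EuclideanSpace ℝ (Fin d))) (y : EuclideanSpace ℝ (Fin d)) :
    EuclideanSpace ℝ (Fin d) :=
  Classical.epsilon (IsTilt P y)

/-- The half-space `{x | s_aᵀ(x - a) ≥ 0}`. -/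
def halfSpace {d : ℕ} (P : Measure (EuclideanSpace ℝ (Fin d))) (a : EuclideanSpace ℝ (Fin d)) :
    Set (EuclideanSpace ℝ (Fin d)) :=
  {x | 0 ≤ (inner ℝ (tilt P a) (x - a) : ℝ)}

/-- `A` is a dominating set for `E`: its points lie in `E` (and in the interior of the domain of
`I`, where `s_a` exists), the half-spaces of its points cover `E`, and this fails after the removal
of any point. -/
structure IsDominatingSet {d : ℕ} (P : Measure (EuclideanSpace ℝ (Fin d)))
    (E A : Set (EuclideanSpace ℝ (Fin d))) : Prop where
  subset : A ⊆ E
  tiltable : ∀ a ∈ A, a ∈ interior (effDomain (rate P)) ∧ ∃ s, IsTilt P a s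
  cover : ∀ x ∈ E, ∃ a ∈ A, x ∈ halfSpace P a
  minimal : ∀ a ∈ A, ¬ ∀ x ∈ E, ∃ b ∈ A \ {a}, x ∈ halfSpace P b

/-! ### Asymptotic comparison relative to `-log p` -/

/-- `-log p(γ)` with `p(γ) = P(X ∈ {g ≥ γ})`. -/
def negLogP {d : ℕ} (P : Measure (EuclideanSpace ℝ (Fin d)))
    (g : EuclideanSpace ℝ (Fin d) → ℝ) (γ : ℝ) : ℝ :=
  -Real.log (P.real (rareSet g γ))

/-- `α ≤ β` up to a factor that grows at most subexponentially in `l`. -/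
def SubexpLE (l : ℝ → ℝ) (α β : ℝ → ℝ≥0∞) : Prop :=
  ∀ ε : ℝ, 0 < ε → ∀ᶠ γ in atTop, α γ ≤ β γ * ENNReal.ofReal (Real.exp (ε * l γ))

/-- `α ∼ β`: the quotient grows or decays at most subexponentially in `l`. -/
def SubexpEquiv (l : ℝ → ℝ) (α β : ℝ → ℝ≥0∞) : Prop :=
  SubexpLE l α β ∧ SubexpLE l β α

/-- `α` decays exponentially in `l`. -/
def ExpDecay (l : ℝ → ℝ) (α : ℝ → ℝ≥0∞) : Prop :=
  ∃ c : ℝ, 0 < c ∧ ∀ᶠ γ in atTop, α γ ≤ ENNReal.ofReal (Real.exp (-(c * l γ)))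

/-! ### Importance sampling with the first `k` points of a list (indexed from `0`) -/

/-- The density `f̃(x) = f(x) ∑_{i<k} (1/k) exp(s_{a_i}ᵀx - μ(s_{a_i}))`. -/
def isDensity {d : ℕ} (f : EuclideanSpace ℝ (Fin d) → ℝ) (a : ℕ → EuclideanSpace ℝ (Fin d))
    (k : ℕ) (x : EuclideanSpace ℝ (Fin d)) : ℝ :=
  f x * ∑ i ∈ Finset.range k, (1 / (k : ℝ)) *
    Real.exp ((inner ℝ (tilt (lawOf f) (a i)) x : ℝ) - cumulantReal (lawOf f) (tilt (lawOf f) (a i)))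

/-- `𝓔₁`: the part of `E` covered by the half-spaces of the first `k` points. -/
def coveredPart {d : ℕ} (P : Measure (EuclideanSpace ℝ (Fin d)))
    (E : Set (EuclideanSpace ℝ (Fin d))) (a : ℕ → EuclideanSpace ℝ (Fin d)) (k : ℕ) :
    Set (EuclideanSpace ℝ (Fin d)) :=
  {x | x ∈ E ∧ ∃ i < k, x ∈ halfSpace P (a i)}

/-- `𝓔₂ = E \ 𝓔₁`. -/
def missedPart {d : ℕ} (P : Measure (EuclideanSpace ℝ (Fin d)))
    (E : Set (EuclideanSpace ℝ (Fin d))) (a : ℕ → EuclideanSpace ℝ (Fin d)) (k : ℕ) :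
    Set (EuclideanSpace ℝ (Fin d)) :=
  E \ coveredPart P E a k

/-- The partial estimator `Z₁ = 1_{𝓔₁}(x) f(x) / f̃(x)`. -/
def partialEstimator {d : ℕ} (f : EuclideanSpace ℝ (Fin d) → ℝ)
    (E : Set (EuclideanSpace ℝ (Fin d))) (a : ℕ → EuclideanSpace ℝ (Fin d)) (k : ℕ) :
    EuclideanSpace ℝ (Fin d) → ℝ :=
  (coveredPart (lawOf f) E a k).indicator fun x => f x / isDensity f a k x

/-- The rate of the first point not used, `∞` if all `r` points are used. -/
def nextRate {d : ℕ} (P : Measure (EuclideanSpace ℝ (Fin d))) (a : ℕ → EuclideanSpace ℝ (Fin d))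
    (r k : ℕ) : EReal :=
  if k < r then rate P (a k) else ⊤

/-- Assumption on the problem, for `X` with density `f` and the rare-event sets `{g ≥ γ}`,
`γ ≥ γ₀`; for each `γ` the dominating set is `{a γ 0, …, a γ (r γ - 1)}`. -/
structure ProblemAssumption {d : ℕ} (f g : EuclideanSpace ℝ (Fin d) → ℝ) (γ₀ : ℝ)
    (a : ℝ → ℕ → EuclideanSpace ℝ (Fin d)) (r : ℝ → ℕ) : Prop where
  isProb : IsProbabilityMeasure (lawOf f)
  closed : ∀ γ, IsClosed (rareSet g γ)
  rare : Tendsto (fun γ => lawOf f (rareSet g γ)) atTop (𝓝 0)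
  cumulant : CumulantAssumption (lawOf f)
  inf_pos : ∀ γ, γ₀ ≤ γ → 0 < (⨅ x ∈ rareSet g γ, rate (lawOf f) x)
  inf_lt_top : ∀ γ, γ₀ ≤ γ → (⨅ x ∈ rareSet g γ, rate (lawOf f) x) < ⊤
  dominating : ∀ γ, γ₀ ≤ γ → IsDominatingSet (lawOf f) (rareSet g γ) (a γ '' Iio (r γ))
  distinct : ∀ γ, γ₀ ≤ γ → InjOn (a γ) (Iio (r γ))
  sorted : ∀ γ, γ₀ ≤ γ → ∀ i j, i ≤ j → j < r γ → rate (lawOf f) (a γ i) ≤ rate (lawOf f) (a γ j)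
  subexp : SubexpLE (negLogP (lawOf f) g) (fun γ => (r γ : ℝ≥0∞)) (fun _ => 1)

/-- Assumption on `p₁` and `p₂`: `p₁ ∼ exp(-I(a₁))`, `p₂ ≤ exp(-I(a_{k+1}))` up to a subexponential
factor, and `exp(I(a₁) - I(a_{k+1}))` decays exponentially. -/
structure MissedProbAssumption {d : ℕ} (f g : EuclideanSpace ℝ (Fin d) → ℝ)
    (a : ℝ → ℕ → EuclideanSpace ℝ (Fin d)) (r k : ℝ → ℕ) : Prop where
  p₁_equiv : SubexpEquiv (negLogP (lawOf f) g)
    (fun γ => lawOf f (coveredPart (lawOf f) (rareSet g γ) (a γ) (k γ)))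
    (fun γ => EReal.exp (-rate (lawOf f) (a γ 0)))
  p₂_le : SubexpLE (negLogP (lawOf f) g)
    (fun γ => lawOf f (missedPart (lawOf f) (rareSet g γ) (a γ) (k γ)))
    (fun γ => EReal.exp (-nextRate (lawOf f) (a γ) (r γ) (k γ)))
  gap : ExpDecay (negLogP (lawOf f) g)
    (fun γ => EReal.exp (rate (lawOf f) (a γ 0) - nextRate (lawOf f) (a γ) (r γ) (k γ)))

/-- Assumption on `p̃₂`: the probability of `𝓔₂` under the sampling distribution decays
exponentially. -/
def MissedSamplingAssumption {d : ℕ} (f g : EuclideanSpace ℝ (Fin d) → ℝ)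
    (a : ℝ → ℕ → EuclideanSpace ℝ (Fin d)) (k : ℝ → ℕ) : Prop :=
  ExpDecay (negLogP (lawOf f) g) fun γ =>
    lawOf (isDensity f (a γ) (k γ)) (missedPart (lawOf f) (rareSet g γ) (a γ) (k γ))

/-- Assumption on the variance: `exp(-2 I(a₁)) / Var(Z₁)`, the variance being taken under the
sampling distribution, grows at most subexponentially (in particular the variance is eventually
positive). -/
def VarianceAssumption {d : ℕ} (f g : EuclideanSpace ℝ (Fin d) → ℝ)
    (a : ℝ → ℕ → EuclideanSpace ℝ (Fin d)) (k : ℝ → ℕ) : Prop :=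
  SubexpLE (negLogP (lawOf f) g)
    (fun γ => EReal.exp (-rate (lawOf f) (a γ 0)) ^ 2)
    (fun γ => ENNReal.ofReal
      (variance (partialEstimator f (rareSet g γ) (a γ) (k γ)) (lawOf (isDensity f (a γ) (k γ)))))

/-! ### Gaussian input and the stopping strategy -/

/-- The bilinear form `vᵀ Σ⁻¹ w`. -/
def precForm {d : ℕ} (S : Matrix (Fin d) (Fin d) ℝ) (v w : EuclideanSpace ℝ (Fin d)) : ℝ :=
  dotProduct v.ofLp (S⁻¹.mulVec w.ofLp)

/-- The density `φ(x; m, Σ)` of `N(m, Σ)`. -/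
def gaussianDensity {d : ℕ} (m : EuclideanSpace ℝ (Fin d)) (S : Matrix (Fin d) (Fin d) ℝ)
    (x : EuclideanSpace ℝ (Fin d)) : ℝ :=
  (Real.sqrt ((2 * Real.pi) ^ d * S.det))⁻¹ * Real.exp (-(1 / 2) * precForm S (x - m) (x - m))

/-- The feasible set of the search after `a 0, …, a (j - 1)` have been found:
`{x ∈ E | (a_i - λ)ᵀ Σ⁻¹ (x - a_i) < 0 for all i < j}`. -/
def feasible {d : ℕ} (m : EuclideanSpace ℝ (Fin d)) (S : Matrix (Fin d) (Fin d) ℝ)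
    (E : Set (EuclideanSpace ℝ (Fin d))) (a : ℕ → EuclideanSpace ℝ (Fin d)) (j : ℕ) :
    Set (EuclideanSpace ℝ (Fin d)) :=
  {x | x ∈ E ∧ ∀ i < j, precForm S (a i - m) (x - a i) < 0}

/-- `a j` minimizes `(x - λ)ᵀ Σ⁻¹ (x - λ)` over the feasible set after `a 0, …, a (j - 1)`. -/
def IsNextPoint {d : ℕ} (m : EuclideanSpace ℝ (Fin d)) (S : Matrix (Fin d) (Fin d) ℝ)
    (E : Set (EuclideanSpace ℝ (Fin d))) (a : ℕ → EuclideanSpace ℝ (Fin d)) (j : ℕ) : Prop :=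
  a j ∈ feasible m S E a j ∧
    ∀ x ∈ feasible m S E a j, precForm S (a j - m) (a j - m) ≤ precForm S (x - m) (x - m)

/-- The break test when `a j` has been found: it is not the first point, and its quadratic rate
exceeds `C` times that of the point before it. -/
def BreaksAt {d : ℕ} (m : EuclideanSpace ℝ (Fin d)) (S : Matrix (Fin d) (Fin d) ℝ) (C : ℝ)
    (a : ℕ → EuclideanSpace ℝ (Fin d)) (j : ℕ) : Prop :=
  0 < j ∧ C * precForm S (a (j - 1) - m) (a (j - 1) - m) < precForm S (a j - m) (a j - m)

/-- `a` lists the points found by the search with the stopping strategy: as long as there was no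
break and the feasible set is non-empty, the next entry is a minimizer. No termination is required,
and entries that are not reached are arbitrary. -/
def IsStoppedSearch {d : ℕ} (m : EuclideanSpace ℝ (Fin d)) (S : Matrix (Fin d) (Fin d) ℝ) (C : ℝ)
    (E : Set (EuclideanSpace ℝ (Fin d))) (a : ℕ → EuclideanSpace ℝ (Fin d)) : Prop :=
  ∀ j, (∀ i < j, ¬ BreaksAt m S C a i) → (feasible m S E a j).Nonempty → IsNextPoint m S E a j

/-- `a` lists the points found by the search without stopping. -/
def IsFullSearch {d : ℕ} (m : EuclideanSpace ℝ (Fin d)) (S : Matrix (Fin d) (Fin d) ℝ)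
    (E : Set (EuclideanSpace ℝ (Fin d))) (a : ℕ → EuclideanSpace ℝ (Fin d)) : Prop :=
  ∀ j, (feasible m S E a j).Nonempty → IsNextPoint m S E a j

/-- The search ends with exactly the `k` points `a 0, …, a (k - 1)`: up to then the feasible sets
were non-empty and there was no break, and now the feasible set is empty or there is a break. -/
def StopsAt {d : ℕ} (m : EuclideanSpace ℝ (Fin d)) (S : Matrix (Fin d) (Fin d) ℝ) (C : ℝ)
    (E : Set (EuclideanSpace ℝ (Fin d))) (a : ℕ → EuclideanSpace ℝ (Fin d)) (k : ℕ) : Prop :=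
  (∀ i < k, (feasible m S E a i).Nonempty ∧ ¬ BreaksAt m S C a i) ∧
    (feasible m S E a k = ∅ ∨ BreaksAt m S C a k)

end RareEvent

end

/-!
Write `B(v, w) = vᵀ Σ⁻¹ w` (`precForm`) and `q(x) = B(x - λ, x - λ)`. For the Gaussian law
everything is explicit: `I = q / 2`, `s_a = Σ⁻¹ (a - λ)`, the half-space of `a` is `{x | B(a - λ,
x - a) ≥ 0}`, and tilting by `s_a` turns `N(λ, Σ)` into `N(a, Σ)` (`gaussianDensity_tilt`). In
particular the half-space of `a` has probability at most `exp (-q(a) / 2)` (`lawOf_halfSpace_le`).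

*The search.* The rare-event set is a union of `N` closed convex polyhedra, `N` not depending on
`γ`. When the search picks a point of one of them, the variational inequality for the minimizer
shows that the whole feasible part of this polyhedron is covered from then on
(`IsNextPoint.notMem_feasible`). Hence there are at most `N` steps. If minima cease to be attained
after the stopping rule has applied, the feasible part of each polyhedron is covered by the
half-space of the nearest point of its closure, and a minimal subfamily of these points completes
the points found to a dominating set of at most `2N` points (`exists_completion`). A point found
by the search is never covered by another point at least as far from the mean
(`eq_of_precForm_nonneg`), which gives minimality.

*Asymptotics.* Let `Q = q(a₁)`, which tends to infinity. Chernoff's bound gives `p ≤ 2N exp (-Q /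
2)`. Conversely, for large `γ` the point `a₁` lies in a full-dimensional polyhedron on which `g`
is unbounded above; by the theory of linear programs (`exists_recession_direction`) `g` increases
along a recession direction, and moving from `a₁` by a small multiple of its norm leads to a ball
of fixed radius inside the rare-event set (`exists_ball_near`). This piece lies in the half-space
of `a₁`, so `p₁ ≥ exp (-(1 + ε) Q / 2)` for large `γ`
(`IsSearchFamily.eventually_le_lawOf_coveredPart`), and `-log p` is asymptotic to `Q / 2`. When `k
< r` the stopping rule gives `q(a_{k+1}) > C q(a_i)` for `i ≤ k`, hence the exponential gap; and
`q(x) = q(a_i) + 2 B(a_i - λ, x - a_i) + B(x - a_i, x - a_i)` shows that on `𝓔₂` the form about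
each `a_i` is at least `(C - 1) Q`, so that `𝓔₂` lies in the tails of all mixture components.
Finally `Z₁` is bounded, has mean `p₁` and vanishes outside `𝓔₁`, so its variance is at least `p₁
^ 2 * P̃(𝓔₁ᶜ)`; and `P̃(𝓔₁ᶜ)` is bounded below because `𝓔₁` does not meet the ellipsoid `{q < Q}`,
to which `N(a₁, Σ)` gives at least a constant mass.
-/

namespace RareEvent

variable {d : ℕ}

/-! ### The quadratic form of the precision matrix -/

theorem precForm_add_left (S : Matrix (Fin d) (Fin d) ℝ) (u v w : EuclideanSpace ℝ (Fin d)) :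
    precForm S (u + v) w = precForm S u w + precForm S v w := by
  simp [precForm, add_dotProduct]

theorem precForm_add_right (S : Matrix (Fin d) (Fin d) ℝ) (u v w : EuclideanSpace ℝ (Fin d)) :
    precForm S u (v + w) = precForm S u v + precForm S u w := by
  simp [precForm, Matrix.mulVec_add, dotProduct_add]

theorem precForm_smul_left (S : Matrix (Fin d) (Fin d) ℝ) (c : ℝ)
    (v w : EuclideanSpace ℝ (Fin d)) : precForm S (c • v) w = c * precForm S v w := by
  simp [precForm, smul_dotProduct]

theorem precForm_smul_right (S : Matrix (Fin d) (Fin d) ℝ) (c : ℝ)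
    (v w : EuclideanSpace ℝ (Fin d)) : precForm S v (c • w) = c * precForm S v w := by
  simp [precForm, Matrix.mulVec_smul, dotProduct_smul]

theorem precForm_sub_left (S : Matrix (Fin d) (Fin d) ℝ) (u v w : EuclideanSpace ℝ (Fin d)) :
    precForm S (u - v) w = precForm S u w - precForm S v w := by
  simp [precForm, sub_dotProduct]

theorem precForm_sub_right (S : Matrix (Fin d) (Fin d) ℝ) (u v w : EuclideanSpace ℝ (Fin d)) :
    precForm S u (v - w) = precForm S u v - precForm S u w := by
  simp [precForm, Matrix.mulVec_sub, dotProduct_sub]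

theorem precForm_zero_right (S : Matrix (Fin d) (Fin d) ℝ) (v : EuclideanSpace ℝ (Fin d)) :
    precForm S v 0 = 0 := by
  simp [precForm]

theorem precForm_eq_inner (S : Matrix (Fin d) (Fin d) ℝ) (v w : EuclideanSpace ℝ (Fin d)) :
    precForm S v w = inner ℝ v (WithLp.toLp 2 (S⁻¹.mulVec w.ofLp)) := by
  simp [precForm, EuclideanSpace.inner_eq_star_dotProduct, dotProduct_comm]

open scoped MatrixOrder Matrix.Norms.L2Operator in
/-- Whitening: in suitable linear coordinates the precision form is the standard inner product. -/
theorem exists_whitening {S : Matrix (Fin d) (Fin d) ℝ} (hS : S.PosDef) :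
    ∃ T : EuclideanSpace ℝ (Fin d) ≃L[ℝ] EuclideanSpace ℝ (Fin d),
      (∀ v w, precForm S v w = inner ℝ (T v) (T w)) ∧
      |LinearMap.det (T : EuclideanSpace ℝ (Fin d) →ₗ[ℝ] EuclideanSpace ℝ (Fin d))| =
        (√S.det)⁻¹ := by

  obtain ⟨A, hA⟩ := (CStarAlgebra.nonneg_iff_eq_star_mul_self (a := S⁻¹)).mp
    (Matrix.nonneg_iff_posSemidef.2 hS.inv.posSemidef)
  have hdet : A.det ^ 2 = S.det⁻¹ := by
    have := congrArg Matrix.det hA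
    rw [Matrix.det_mul, Matrix.star_eq_conjTranspose, Matrix.det_conjTranspose,
      Matrix.det_nonsing_inv] at this
    simp only [star_trivial, Ring.inverse_eq_inv'] at this
    rw [this]; ring
  have hpos := hS.det_pos
  have hA0 : LinearMap.det (Matrix.toLpLin 2 2 A) ≠ 0 := by
    rw [LinearMap.det_toLpLin]
    intro h
    rw [h] at hdet
    have : 0 < S.det⁻¹ := inv_pos.2 hpos
    simp at hdet
    linarith
  refine ⟨(LinearMap.equivOfDetNeZero _ hA0).toContinuousLinearEquiv, fun v w => ?_, ?_⟩
  · have h1 : ∀ v, (LinearMap.equivOfDetNeZero _ hA0).toContinuousLinearEquiv v =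
      WithLp.toLp 2 (A.mulVec v.ofLp) := fun v => rfl
    rw [h1, h1, precForm, hA, Matrix.star_eq_conjTranspose,
      EuclideanSpace.inner_eq_star_dotProduct]
    simp only [star_trivial]
    rw [dotProduct_comm, ← Matrix.mulVec_mulVec, dotProduct_comm, Matrix.dotProduct_mulVec,
      Matrix.vecMul_conjTranspose, dotProduct_comm]
    simp
  · have h1 : (((LinearMap.equivOfDetNeZero _ hA0).toContinuousLinearEquiv :
        EuclideanSpace ℝ (Fin d) ≃L[ℝ] EuclideanSpace ℝ (Fin d)) :
        EuclideanSpace ℝ (Fin d) →ₗ[ℝ] EuclideanSpace ℝ (Fin d)) = Matrix.toLpLin 2 2 A := rfl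
    rw [h1, LinearMap.det_toLpLin, ← Real.sqrt_sq_eq_abs, hdet, Real.sqrt_inv]

theorem precForm_comm {S : Matrix (Fin d) (Fin d) ℝ} (hS : S.PosDef)
    (v w : EuclideanSpace ℝ (Fin d)) : precForm S v w = precForm S w v := by
  obtain ⟨T, hT, -⟩ := exists_whitening hS
  rw [hT, hT, real_inner_comm]

theorem precForm_self_nonneg {S : Matrix (Fin d) (Fin d) ℝ} (hS : S.PosDef)
    (v : EuclideanSpace ℝ (Fin d)) : 0 ≤ precForm S v v := by
  obtain ⟨T, hT, -⟩ := exists_whitening hS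
  rw [hT]
  exact real_inner_self_nonneg

theorem precForm_self_pos {S : Matrix (Fin d) (Fin d) ℝ} (hS : S.PosDef)
    {v : EuclideanSpace ℝ (Fin d)} (hv : v ≠ 0) : 0 < precForm S v v := by
  obtain ⟨T, hT, -⟩ := exists_whitening hS
  rw [hT]
  exact real_inner_self_pos.2 (by simpa using hv)

theorem continuous_precForm (S : Matrix (Fin d) (Fin d) ℝ) :
    Continuous fun p : EuclideanSpace ℝ (Fin d) × EuclideanSpace ℝ (Fin d) =>
      precForm S p.1 p.2 := by
  unfold precForm
  fun_prop

theorem _root_.Continuous.precForm {X : Type*} [TopologicalSpace X]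
    {u v : X → EuclideanSpace ℝ (Fin d)} (S : Matrix (Fin d) (Fin d) ℝ)
    (hu : Continuous u) (hv : Continuous v) : Continuous fun x => precForm S (u x) (v x) :=
  (continuous_precForm S).comp (hu.prodMk hv)

/-- Decomposition of the quadratic form about a second centre. -/
theorem precForm_shift {S : Matrix (Fin d) (Fin d) ℝ} (hS : S.PosDef)
    (m a x : EuclideanSpace ℝ (Fin d)) :
    precForm S (x - m) (x - m) = precForm S (a - m) (a - m) + 2 * precForm S (a - m) (x - a) +
      precForm S (x - a) (x - a) := by
  have : x - m = (a - m) + (x - a) := by abel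
  rw [this, precForm_add_left, precForm_add_right, precForm_add_right,
    precForm_comm hS (x - a) (a - m)]
  ring

/-! ### Gaussian densities -/

theorem continuous_gaussianDensity (m : EuclideanSpace ℝ (Fin d)) (S : Matrix (Fin d) (Fin d) ℝ) :
    Continuous (gaussianDensity m S) := by
  have := Continuous.precForm S (continuous_id.sub (continuous_const (y := m)))
    (continuous_id.sub (continuous_const (y := m)))
  unfold gaussianDensity
  fun_prop

/-- The normalizing constant of the density of `N(m, Σ)`. -/
noncomputable def gaussianConst (S : Matrix (Fin d) (Fin d) ℝ) : ℝ :=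
  (√((2 * Real.pi) ^ d * S.det))⁻¹

theorem gaussianConst_pos {S : Matrix (Fin d) (Fin d) ℝ} (hS : S.PosDef) :
    0 < gaussianConst S := by
  have := hS.det_pos
  unfold gaussianConst
  positivity

theorem gaussianDensity_eq (m : EuclideanSpace ℝ (Fin d)) (S : Matrix (Fin d) (Fin d) ℝ)
    (x : EuclideanSpace ℝ (Fin d)) :
    gaussianDensity m S x =
      gaussianConst S * Real.exp (-(1 / 2) * precForm S (x - m) (x - m)) := rfl

theorem gaussianDensity_pos {S : Matrix (Fin d) (Fin d) ℝ} (hS : S.PosDef)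
    (m x : EuclideanSpace ℝ (Fin d)) : 0 < gaussianDensity m S x := by
  have := gaussianConst_pos hS
  rw [gaussianDensity_eq]
  positivity

theorem lintegral_gaussianDensity {S : Matrix (Fin d) (Fin d) ℝ} (hS : S.PosDef)
    (m : EuclideanSpace ℝ (Fin d)) :
    ∫⁻ x, ENNReal.ofReal (gaussianDensity m S x) = 1 := by
  obtain ⟨T, hT, hdet⟩ := exists_whitening hS
  have hpos := hS.det_pos
  have hd0 : LinearMap.det (T : EuclideanSpace ℝ (Fin d) →ₗ[ℝ] EuclideanSpace ℝ (Fin d)) ≠ 0 := by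
    rw [← abs_pos, hdet]
    positivity
  have hshift : ∫⁻ x, ENNReal.ofReal (gaussianDensity m S x) =
      ∫⁻ x, ENNReal.ofReal (gaussianConst S * Real.exp (-(1 / 2) * ‖T x‖ ^ 2)) := by
    rw [← lintegral_sub_right_eq_self
      (fun x => ENNReal.ofReal (gaussianConst S * Real.exp (-(1 / 2) * ‖T x‖ ^ 2))) m]
    refine lintegral_congr fun x => ?_
    rw [gaussianDensity_eq, hT, real_inner_self_eq_norm_sq]
  have hmap := Measure.map_linearMap_addHaar_eq_smul_addHaar
    (volume : Measure (EuclideanSpace ℝ (Fin d))) hd0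
  have hmeas : Measurable fun z : EuclideanSpace ℝ (Fin d) =>
      ENNReal.ofReal (gaussianConst S * Real.exp (-(1 / 2) * ‖z‖ ^ 2)) := by fun_prop
  have h2 : ∫⁻ x, ENNReal.ofReal (gaussianConst S * Real.exp (-(1 / 2) * ‖T x‖ ^ 2)) =
      ∫⁻ z, ENNReal.ofReal (gaussianConst S * Real.exp (-(1 / 2) * ‖z‖ ^ 2))
        ∂(Measure.map (T : EuclideanSpace ℝ (Fin d) →ₗ[ℝ] EuclideanSpace ℝ (Fin d)) volume) := by
    rw [lintegral_map hmeas]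
    · rfl
    · exact T.continuous.measurable
  have hgauss := GaussianFourier.integral_rexp_neg_mul_sq_norm
    (V := EuclideanSpace ℝ (Fin d)) (b := 1 / 2) (by norm_num)
  have hint : Integrable fun z : EuclideanSpace ℝ (Fin d) => Real.exp (-(1 / 2) * ‖z‖ ^ 2) := by
    refine Integrable.of_integral_ne_zero ?_
    rw [hgauss]
    positivity
  have h3 : ∫⁻ z : EuclideanSpace ℝ (Fin d),
      ENNReal.ofReal (gaussianConst S * Real.exp (-(1 / 2) * ‖z‖ ^ 2)) =
      ENNReal.ofReal (√S.det)⁻¹ := by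
    rw [← ofReal_integral_eq_lintegral_ofReal (hint.const_mul _)
      (Eventually.of_forall fun z => by have := gaussianConst_pos hS; positivity),
      integral_const_mul, hgauss]
    congr 1
    have h2pi : (Real.pi / (1 / 2)) ^ ((Module.finrank ℝ (EuclideanSpace ℝ (Fin d)) : ℝ) / 2) =
        √((2 * Real.pi) ^ d) := by
      rw [finrank_euclideanSpace_fin, Real.sqrt_eq_rpow, ← Real.rpow_natCast, ← Real.rpow_mul
        (by positivity)]
      congr 1 <;> ring
    rw [h2pi, gaussianConst, Real.sqrt_mul (by positivity), mul_inv]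
    have : √((2 * Real.pi) ^ d) ≠ 0 := by positivity
    field_simp
  rw [hshift, h2, hmap, lintegral_smul_measure, h3, smul_eq_mul, abs_inv, hdet, inv_inv,
    ← ENNReal.ofReal_mul (by positivity), mul_inv_cancel₀ (by positivity), ENNReal.ofReal_one]

theorem measurable_ofReal_gaussianDensity (m : EuclideanSpace ℝ (Fin d))
    (S : Matrix (Fin d) (Fin d) ℝ) :
    Measurable fun x => ENNReal.ofReal (gaussianDensity m S x) :=
  (continuous_gaussianDensity m S).measurable.ennreal_ofReal

theorem isProbabilityMeasure_lawOf_gaussianDensity {S : Matrix (Fin d) (Fin d) ℝ} (hS : S.PosDef)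
    (m : EuclideanSpace ℝ (Fin d)) : IsProbabilityMeasure (lawOf (gaussianDensity m S)) :=
  ⟨by rw [lawOf, withDensity_apply _ MeasurableSet.univ, Measure.restrict_univ,
    lintegral_gaussianDensity hS]⟩

/-- A Gaussian density is an exponential tilt of the density with any other mean and the same
covariance matrix. -/
theorem gaussianDensity_tilt {S : Matrix (Fin d) (Fin d) ℝ} (hS : S.PosDef)
    (m a x : EuclideanSpace ℝ (Fin d)) :
    gaussianDensity m S x = Real.exp (-(1 / 2) * precForm S (a - m) (a - m)
      - precForm S (a - m) (x - a)) * gaussianDensity a S x := by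
  rw [gaussianDensity_eq, gaussianDensity_eq, mul_left_comm, ← Real.exp_add,
    precForm_shift hS m a x]
  congr 2
  ring

/-! ### Cumulant generating function, rate function and tilting vectors of a Gaussian law -/

/-- The covariance matrix as an operator. -/
noncomputable def covMap (S : Matrix (Fin d) (Fin d) ℝ) :
    EuclideanSpace ℝ (Fin d) →L[ℝ] EuclideanSpace ℝ (Fin d) :=
  Matrix.toEuclideanCLM (𝕜 := ℝ) S

theorem exists_covMap_eq {S : Matrix (Fin d) (Fin d) ℝ} (hS : S.PosDef)
    (v : EuclideanSpace ℝ (Fin d)) : ∃ s, covMap S s = v := by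
  refine ⟨WithLp.toLp 2 (S⁻¹.mulVec v.ofLp), ?_⟩
  have hu := (Matrix.isUnit_iff_isUnit_det _).1 hS.isUnit
  ext i
  simp [covMap, Matrix.mulVec_mulVec, Matrix.mul_nonsing_inv _ hu]

theorem precForm_covMap_right {S : Matrix (Fin d) (Fin d) ℝ} (hS : S.PosDef)
    (v s : EuclideanSpace ℝ (Fin d)) : precForm S v (covMap S s) = inner ℝ v s := by
  have hu := (Matrix.isUnit_iff_isUnit_det _).1 hS.isUnit
  rw [precForm_eq_inner]
  congr 1
  ext i
  simp [covMap, Matrix.ofLp_toEuclideanCLM, Matrix.mulVec_mulVec, Matrix.nonsing_inv_mul _ hu]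

theorem precForm_covMap_left {S : Matrix (Fin d) (Fin d) ℝ} (hS : S.PosDef)
    (v s : EuclideanSpace ℝ (Fin d)) : precForm S (covMap S s) v = inner ℝ s v := by
  rw [precForm_comm hS, precForm_covMap_right hS, real_inner_comm]

theorem inner_covMap_comm {S : Matrix (Fin d) (Fin d) ℝ} (hS : S.PosDef)
    (v s : EuclideanSpace ℝ (Fin d)) :
    (inner ℝ (covMap S v) s : ℝ) = inner ℝ v (covMap S s) := by
  rw [← precForm_covMap_right hS, precForm_covMap_left hS]

theorem inner_covMap_self_pos {S : Matrix (Fin d) (Fin d) ℝ} (hS : S.PosDef)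
    {s : EuclideanSpace ℝ (Fin d)} (hs : s ≠ 0) : 0 < (inner ℝ s (covMap S s) : ℝ) := by
  rw [← precForm_covMap_left hS]
  refine precForm_self_pos hS fun h => hs ?_
  have h2 := precForm_covMap_left hS s s
  rw [h] at h2
  have h3 : precForm S 0 s = 0 := by simp [precForm]
  rw [h3] at h2
  exact inner_self_eq_zero.1 h2.symm

theorem lintegral_exp_inner_gaussian {S : Matrix (Fin d) (Fin d) ℝ} (hS : S.PosDef)
    (m x : EuclideanSpace ℝ (Fin d)) :
    ∫⁻ y, ENNReal.ofReal (Real.exp (inner ℝ x y)) ∂(lawOf (gaussianDensity m S)) =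
      ENNReal.ofReal (Real.exp (inner ℝ x m + 1 / 2 * inner ℝ x (covMap S x))) := by
  rw [lawOf, lintegral_withDensity_eq_lintegral_mul _ (measurable_ofReal_gaussianDensity m S)
    (by fun_prop)]
  have h : ∀ y, ((fun y => ENNReal.ofReal (gaussianDensity m S y)) *
      fun y => ENNReal.ofReal (Real.exp (inner ℝ x y))) y =
      ENNReal.ofReal (Real.exp (inner ℝ x m + 1 / 2 * inner ℝ x (covMap S x))) *
        ENNReal.ofReal (gaussianDensity (m + covMap S x) S y) := by
    intro y
    rw [Pi.mul_apply, gaussianDensity_tilt hS m (m + covMap S x) y,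
      ← ENNReal.ofReal_mul (by have := gaussianDensity_pos hS (m + covMap S x) y; positivity),
      ← ENNReal.ofReal_mul (by positivity), mul_right_comm, ← Real.exp_add, add_sub_cancel_left,
      precForm_covMap_left hS, precForm_covMap_left hS, inner_sub_right, inner_add_right]
    congr 3
    ring
  rw [lintegral_congr h, lintegral_const_mul _ (measurable_ofReal_gaussianDensity _ S),
    lintegral_gaussianDensity hS, mul_one]

theorem cumulant_gaussian {S : Matrix (Fin d) (Fin d) ℝ} (hS : S.PosDef)
    (m x : EuclideanSpace ℝ (Fin d)) :
    cumulant (lawOf (gaussianDensity m S)) x =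
      ((inner ℝ x m + 1 / 2 * inner ℝ x (covMap S x) : ℝ) : EReal) := by
  rw [cumulant, lintegral_exp_inner_gaussian hS, ENNReal.log_ofReal_of_pos (Real.exp_pos _),
    Real.log_exp]

theorem cumulantReal_gaussian {S : Matrix (Fin d) (Fin d) ℝ} (hS : S.PosDef)
    (m : EuclideanSpace ℝ (Fin d)) :
    cumulantReal (lawOf (gaussianDensity m S)) =
      fun x => (inner ℝ x m + 1 / 2 * inner ℝ x (covMap S x) : ℝ) := by
  ext x
  rw [cumulantReal, cumulant_gaussian hS, EReal.toReal_coe]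

theorem effDomain_cumulant_gaussian {S : Matrix (Fin d) (Fin d) ℝ} (hS : S.PosDef)
    (m : EuclideanSpace ℝ (Fin d)) :
    effDomain (cumulant (lawOf (gaussianDensity m S))) = univ := by
  ext x
  simp only [effDomain, mem_ofPred_eq, mem_univ, iff_true]
  rw [cumulant_gaussian hS]
  exact EReal.coe_lt_top _

theorem hasGradientAt_cumulantReal_gaussian {S : Matrix (Fin d) (Fin d) ℝ} (hS : S.PosDef)
    (m s : EuclideanSpace ℝ (Fin d)) :
    HasGradientAt (cumulantReal (lawOf (gaussianDensity m S))) (m + covMap S s) s := by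
  rw [cumulantReal_gaussian hS, hasGradientAt_iff_hasFDerivAt]
  have h1 := (hasFDerivAt_id (𝕜 := ℝ) s).inner ℝ (hasFDerivAt_const m s)
  have h2 := (hasFDerivAt_id (𝕜 := ℝ) s).inner ℝ ((covMap S).hasFDerivAt (x := s))
  refine (h1.add (h2.const_mul (1 / 2))).congr_fderiv ?_
  ext v
  simp only [id_eq, add_apply, ContinuousLinearMap.comp_apply,
    ContinuousLinearMap.prod_apply, fderivInnerCLM_apply, smul_apply,
    zero_apply, ContinuousLinearMap.id_apply, inner_zero_right,
    InnerProductSpace.toDual_apply_apply, smul_eq_mul, inner_add_left]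
  rw [← inner_covMap_comm hS, real_inner_comm v m, real_inner_comm v (covMap S s)]
  ring

theorem strictConvexOn_cumulantReal_gaussian {S : Matrix (Fin d) (Fin d) ℝ} (hS : S.PosDef)
    (m : EuclideanSpace ℝ (Fin d)) :
    StrictConvexOn ℝ univ (cumulantReal (lawOf (gaussianDensity m S))) := by
  rw [cumulantReal_gaussian hS]
  refine ⟨convex_univ, fun x _ y _ hxy α β hα hβ hαβ => ?_⟩
  have hpos := inner_covMap_self_pos hS (sub_ne_zero.2 hxy)
  have hsymm : (inner ℝ y (covMap S x) : ℝ) = inner ℝ x (covMap S y) := by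
    rw [← inner_covMap_comm hS, real_inner_comm]
  simp only [map_sub, inner_sub_left, inner_sub_right, hsymm] at hpos
  simp only [map_add, map_smul, inner_add_left, inner_add_right, real_inner_smul_left,
    real_inner_smul_right, hsymm, smul_eq_mul]
  obtain rfl : β = 1 - α := by linarith
  have := mul_pos (mul_pos hα hβ) hpos
  nlinarith

theorem cumulantAssumption_gaussian {S : Matrix (Fin d) (Fin d) ℝ} (hS : S.PosDef)
    (m : EuclideanSpace ℝ (Fin d)) : CumulantAssumption (lawOf (gaussianDensity m S)) where
  closed := by
    have h : cumulant (lawOf (gaussianDensity m S)) = fun x =>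
        ((inner ℝ x m + 1 / 2 * inner ℝ x (covMap S x) : ℝ) : EReal) :=
      funext (cumulant_gaussian hS m)
    rw [h]
    exact (continuous_coe_real_ereal.comp (by fun_prop)).lowerSemicontinuous
  proper := by
    refine ⟨fun x => ?_, 0, ?_⟩ <;> rw [cumulant_gaussian hS]
    · exact EReal.coe_ne_bot _
    · exact EReal.coe_ne_top _
  convex := by
    have h := (strictConvexOn_cumulantReal_gaussian hS m).convexOn.convex_epigraph
    convert h using 1
    ext z
    simp only [mem_ofPred_eq, mem_univ, true_and]
    rw [cumulant_gaussian hS, cumulantReal_gaussian hS, EReal.coe_le_coe_iff]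
  zero_mem := by simp [effDomain_cumulant_gaussian hS]
  strictConvex := by
    rw [effDomain_cumulant_gaussian hS, interior_univ]
    exact strictConvexOn_cumulantReal_gaussian hS m
  differentiable := fun s _ =>
    (hasGradientAt_cumulantReal_gaussian hS m s).differentiableAt.differentiableWithinAt
  steep := by
    intro x y _ hy
    rw [effDomain_cumulant_gaussian hS, frontier_univ] at hy
    exact hy.elim

theorem rate_gaussian {S : Matrix (Fin d) (Fin d) ℝ} (hS : S.PosDef)
    (m y : EuclideanSpace ℝ (Fin d)) :
    rate (lawOf (gaussianDensity m S)) y =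
      ((1 / 2 * precForm S (y - m) (y - m) : ℝ) : EReal) := by
  have hval : ∀ x, ((inner ℝ x y : ℝ) : EReal) - cumulant (lawOf (gaussianDensity m S)) x =
      ((precForm S (covMap S x) (y - m) - 1 / 2 * precForm S (covMap S x) (covMap S x) : ℝ) :
        EReal) := by
    intro x
    rw [cumulant_gaussian hS, ← EReal.coe_sub, precForm_covMap_left hS, precForm_covMap_left hS,
      inner_sub_right]
    congr 1
    ring
  unfold rate
  simp_rw [hval]
  apply le_antisymm
  · refine iSup_le fun x => EReal.coe_le_coe_iff.2 ?_
    generalize y - m = v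
    have h := precForm_self_nonneg hS (covMap S x - v)
    rw [precForm_sub_left, precForm_sub_right, precForm_sub_right,
      precForm_comm hS v (covMap S x)] at h
    linarith
  · obtain ⟨s, hs⟩ := exists_covMap_eq hS (y - m)
    refine le_iSup_of_le s (EReal.coe_le_coe_iff.2 ?_)
    rw [hs]
    linarith

theorem effDomain_rate_gaussian {S : Matrix (Fin d) (Fin d) ℝ} (hS : S.PosDef)
    (m : EuclideanSpace ℝ (Fin d)) :
    effDomain (rate (lawOf (gaussianDensity m S))) = univ := by
  ext x
  simp only [effDomain, mem_ofPred_eq, mem_univ, iff_true]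
  rw [rate_gaussian hS]
  exact EReal.coe_lt_top _

theorem isTilt_gaussian_iff {S : Matrix (Fin d) (Fin d) ℝ} (hS : S.PosDef)
    (m y s : EuclideanSpace ℝ (Fin d)) :
    IsTilt (lawOf (gaussianDensity m S)) y s ↔ covMap S s = y - m := by
  have hg := hasGradientAt_cumulantReal_gaussian hS m s
  constructor
  · rintro ⟨-, h, -⟩
    rw [h.unique hg, add_sub_cancel_left]
  · intro h
    refine ⟨by simp [effDomain_cumulant_gaussian hS], ?_, ?_⟩
    · rwa [h, add_sub_cancel] at hg
    · rw [rate_gaussian hS, cumulant_gaussian hS, ← EReal.coe_sub, h, ← h,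
        precForm_covMap_left hS, h, inner_sub_right]
      congr 1
      ring

theorem covMap_tilt_gaussian {S : Matrix (Fin d) (Fin d) ℝ} (hS : S.PosDef)
    (m y : EuclideanSpace ℝ (Fin d)) :
    covMap S (tilt (lawOf (gaussianDensity m S)) y) = y - m := by
  rw [← isTilt_gaussian_iff hS]
  obtain ⟨s, hs⟩ := exists_covMap_eq hS (y - m)
  exact Classical.epsilon_spec ⟨s, (isTilt_gaussian_iff hS m y s).2 hs⟩

theorem inner_tilt_gaussian {S : Matrix (Fin d) (Fin d) ℝ} (hS : S.PosDef)
    (m y x : EuclideanSpace ℝ (Fin d)) :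
    inner ℝ (tilt (lawOf (gaussianDensity m S)) y) x = precForm S (y - m) x := by
  rw [← precForm_covMap_left hS, covMap_tilt_gaussian hS]

theorem mem_halfSpace_gaussian_iff {S : Matrix (Fin d) (Fin d) ℝ} (hS : S.PosDef)
    (m a x : EuclideanSpace ℝ (Fin d)) :
    x ∈ halfSpace (lawOf (gaussianDensity m S)) a ↔ 0 ≤ precForm S (a - m) (x - a) := by
  rw [halfSpace, mem_ofPred_eq, inner_tilt_gaussian hS]

/-- Exponential tilting by `s_a` turns `N(m, Σ)` into `N(a, Σ)`. -/
theorem gaussianDensity_mul_exp_tilt {S : Matrix (Fin d) (Fin d) ℝ} (hS : S.PosDef)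
    (m a x : EuclideanSpace ℝ (Fin d)) :
    gaussianDensity m S x * Real.exp (inner ℝ (tilt (lawOf (gaussianDensity m S)) a) x -
      cumulantReal (lawOf (gaussianDensity m S)) (tilt (lawOf (gaussianDensity m S)) a)) =
      gaussianDensity a S x := by
  rw [gaussianDensity_tilt hS m a x, cumulantReal_gaussian hS]
  simp only [covMap_tilt_gaussian hS]
  simp only [inner_tilt_gaussian hS]
  rw [mul_right_comm, ← Real.exp_add]
  convert one_mul _ using 2
  rw [Real.exp_eq_one_iff, precForm_sub_right, precForm_sub_right]
  ring

theorem isDensity_gaussian {S : Matrix (Fin d) (Fin d) ℝ} (hS : S.PosDef)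
    (m : EuclideanSpace ℝ (Fin d)) (a : ℕ → EuclideanSpace ℝ (Fin d)) (k : ℕ)
    (x : EuclideanSpace ℝ (Fin d)) :
    isDensity (gaussianDensity m S) a k x =
      (1 / (k : ℝ)) * ∑ i ∈ Finset.range k, gaussianDensity (a i) S x := by
  rw [isDensity, Finset.mul_sum, Finset.mul_sum]
  refine Finset.sum_congr rfl fun i _ => ?_
  rw [← gaussianDensity_mul_exp_tilt hS m (a i) x]
  ring

/-! ### The search for dominating points -/

theorem continuous_precForm_sub_self (S : Matrix (Fin d) (Fin d) ℝ)
    (m : EuclideanSpace ℝ (Fin d)) : Continuous fun x => precForm S (x - m) (x - m) :=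
  Continuous.precForm S (continuous_id.sub continuous_const) (continuous_id.sub continuous_const)

/-- The variational inequality: a convex set lies in the half-space of a minimizer of the
quadratic form. -/
theorem precForm_nonneg_of_minimizer {S : Matrix (Fin d) (Fin d) ℝ} (hS : S.PosDef)
    {m a : EuclideanSpace ℝ (Fin d)} {K : Set (EuclideanSpace ℝ (Fin d))} (hK : Convex ℝ K)
    (haK : a ∈ K)
    (hmin : ∀ x ∈ K, precForm S (a - m) (a - m) ≤ precForm S (x - m) (x - m))
    {x : EuclideanSpace ℝ (Fin d)} (hx : x ∈ K) : 0 ≤ precForm S (a - m) (x - a) := by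
  have key : ∀ t : ℝ, t ∈ Ioc (0 : ℝ) 1 →
      0 ≤ 2 * precForm S (a - m) (x - a) + t * precForm S (x - a) (x - a) := by
    intro t ht
    have h := hmin _ (hK.add_smul_sub_mem haK hx ⟨ht.1.le, ht.2⟩)
    rw [precForm_shift hS m a (a + t • (x - a)), add_sub_cancel_left, precForm_smul_right,
      precForm_smul_right, precForm_smul_left] at h
    have h2 : 0 ≤ t * (2 * precForm S (a - m) (x - a) + t * precForm S (x - a) (x - a)) := by
      linarith
    exact nonneg_of_mul_nonneg_right h2 ht.1
  have hlim : Tendsto (fun t : ℝ => 2 * precForm S (a - m) (x - a) +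
      t * precForm S (x - a) (x - a)) (𝓝[>] 0)
      (𝓝 (2 * precForm S (a - m) (x - a) + 0 * precForm S (x - a) (x - a))) :=
    tendsto_nhdsWithin_of_tendsto_nhds (Continuous.tendsto (by fun_prop) 0)
  have := ge_of_tendsto hlim (Filter.mem_of_superset (Ioc_mem_nhdsGT one_pos) key)
  linarith

/-- A point lies in the half-space of a point that is at least as far from the mean only if the
two points coincide. -/
theorem eq_of_precForm_nonneg {S : Matrix (Fin d) (Fin d) ℝ} (hS : S.PosDef)
    {m a b : EuclideanSpace ℝ (Fin d)}
    (hab : precForm S (a - m) (a - m) ≤ precForm S (b - m) (b - m))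
    (h : 0 ≤ precForm S (b - m) (a - b)) : a = b := by
  by_contra hne
  have h1 := precForm_self_pos hS (sub_ne_zero.2 hne)
  have h2 := precForm_shift hS m b a
  linarith

theorem exists_minimizer {S : Matrix (Fin d) (Fin d) ℝ} (hS : S.PosDef)
    (m : EuclideanSpace ℝ (Fin d)) {K : Set (EuclideanSpace ℝ (Fin d))} (hK : IsClosed K)
    (hne : K.Nonempty) :
    ∃ z ∈ K, ∀ x ∈ K, precForm S (z - m) (z - m) ≤ precForm S (x - m) (x - m) := by
  obtain ⟨T, hT, -⟩ := exists_whitening hS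
  have hcl : IsClosed ((fun y => T.symm y + m) ⁻¹' K) :=
    hK.preimage (T.symm.continuous.add continuous_const)
  obtain ⟨x₀, hx₀⟩ := hne
  obtain ⟨y, hy, hy2⟩ := hcl.exists_infDist_eq_dist ⟨T (x₀ - m), by simpa using hx₀⟩ 0
  refine ⟨T.symm y + m, hy, fun x hx => ?_⟩
  have h := Metric.infDist_le_dist_of_mem (x := (0 : EuclideanSpace ℝ (Fin d)))
    (s := (fun y => T.symm y + m) ⁻¹' K) (y := T (x - m)) (by simpa using hx)
  rw [hy2, dist_zero_left, dist_zero_left] at h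
  rw [hT, hT, real_inner_self_eq_norm_sq, real_inner_self_eq_norm_sq, add_sub_cancel_right,
    ContinuousLinearEquiv.apply_symm_apply]
  gcongr

theorem feasible_antitone (m : EuclideanSpace ℝ (Fin d)) (S : Matrix (Fin d) (Fin d) ℝ)
    (E : Set (EuclideanSpace ℝ (Fin d))) (a : ℕ → EuclideanSpace ℝ (Fin d)) :
    Antitone (feasible m S E a) :=
  fun _ _ hij _ hx => ⟨hx.1, fun l hl => hx.2 l (hl.trans_le hij)⟩

theorem convex_feasible_inter {m : EuclideanSpace ℝ (Fin d)} {S : Matrix (Fin d) (Fin d) ℝ}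
    {E K : Set (EuclideanSpace ℝ (Fin d))} (hK : Convex ℝ K) (hKE : K ⊆ E)
    (a : ℕ → EuclideanSpace ℝ (Fin d)) (j : ℕ) : Convex ℝ (feasible m S E a j ∩ K) := by
  intro x hx y hy α β hα hβ hαβ
  have hmem := hK hx.2 hy.2 hα hβ hαβ
  refine ⟨⟨hKE hmem, fun i hi => ?_⟩, hmem⟩
  have h1 := hx.1.2 i hi
  have h2 := hy.1.2 i hi
  have h3 : α • x + β • y - a i = α • (x - a i) + β • (y - a i) := by
    have : a i = α • a i + β • a i := by rw [← add_smul, hαβ, one_smul]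
    rw [smul_sub, smul_sub]
    nth_rewrite 1 [this]
    abel
  rw [h3, precForm_add_right, precForm_smul_right, precForm_smul_right]
  rcases hα.eq_or_lt with rfl | hα
  · obtain rfl : β = 1 := by linarith
    linarith
  · have := mul_neg_of_pos_of_neg hα h1
    have := mul_nonpos_of_nonneg_of_nonpos hβ h2.le
    linarith

theorem IsNextPoint.le {m : EuclideanSpace ℝ (Fin d)} {S : Matrix (Fin d) (Fin d) ℝ}
    {E : Set (EuclideanSpace ℝ (Fin d))} {a : ℕ → EuclideanSpace ℝ (Fin d)} {i j : ℕ}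
    (hi : IsNextPoint m S E a i) (hj : IsNextPoint m S E a j) (hij : i ≤ j) :
    precForm S (a i - m) (a i - m) ≤ precForm S (a j - m) (a j - m) :=
  hi.2 _ (feasible_antitone m S E a hij hj.1)

/-- A convex piece of the set is exhausted as soon as the search picks a point of it. -/
theorem IsNextPoint.notMem_feasible {m : EuclideanSpace ℝ (Fin d)} {S : Matrix (Fin d) (Fin d) ℝ}
    (hS : S.PosDef) {E K : Set (EuclideanSpace ℝ (Fin d))} {a : ℕ → EuclideanSpace ℝ (Fin d)}
    {i : ℕ} (hi : IsNextPoint m S E a i) (hK : Convex ℝ K) (hKE : K ⊆ E) (haK : a i ∈ K)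
    {x : EuclideanSpace ℝ (Fin d)} (hx : x ∈ K) : x ∉ feasible m S E a (i + 1) := by
  intro hxf
  have h1 := precForm_nonneg_of_minimizer hS (convex_feasible_inter (m := m) (S := S) hK hKE a i)
    ⟨hi.1, haK⟩ (fun y hy => hi.2 y hy.1)
    ⟨feasible_antitone m S E a (Nat.le_succ i) hxf, hx⟩
  have h2 := hxf.2 i (Nat.lt_succ_self i)
  linarith

/-- The search finds at most one point in each of the convex pieces of the set. -/
theorem search_length_le {m : EuclideanSpace ℝ (Fin d)} {S : Matrix (Fin d) (Fin d) ℝ}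
    (hS : S.PosDef) {N : ℕ} {K : Fin N → Set (EuclideanSpace ℝ (Fin d))}
    (hK : ∀ l, Convex ℝ (K l)) {a : ℕ → EuclideanSpace ℝ (Fin d)} {n : ℕ}
    (ha : ∀ j < n, IsNextPoint m S (⋃ l, K l) a j) : n ≤ N := by
  have hl : ∀ j : Fin n, ∃ l, a j ∈ K l := fun j => mem_iUnion.1 (ha j j.2).1.1
  choose l hl using hl
  have hlt : ∀ i j : Fin n, i < j → l i ≠ l j := by
    intro i j hij h
    refine (ha i i.2).notMem_feasible hS (hK (l i)) (subset_iUnion K (l i)) (hl i)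
      (x := a j) (h ▸ hl j) ?_
    exact feasible_antitone _ _ _ _ (Nat.succ_le_of_lt hij) (ha j j.2).1
  have hinj : Function.Injective l := by
    intro i j h
    rcases lt_trichotomy i j with h' | h' | h'
    · exact (hlt i j h' h).elim
    · exact h'
    · exact (hlt j i h' h.symm).elim
  simpa using Fintype.card_le_of_injective l hinj

/-- A minimal list of points of `E`, ordered by the quadratic form, whose half-spaces cover `E`. -/
structure IsOrderedCover (m : EuclideanSpace ℝ (Fin d)) (S : Matrix (Fin d) (Fin d) ℝ)
    (E : Set (EuclideanSpace ℝ (Fin d))) (b : ℕ → EuclideanSpace ℝ (Fin d)) (r : ℕ) : Prop where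
  mem : ∀ i < r, b i ∈ E
  cover : ∀ x ∈ E, ∃ i < r, 0 ≤ precForm S (b i - m) (x - b i)
  minimal : ∀ i < r, ∃ x ∈ E, ∀ j < r, j ≠ i → precForm S (b j - m) (x - b j) < 0
  sorted : ∀ i j, i ≤ j → j < r →
    precForm S (b i - m) (b i - m) ≤ precForm S (b j - m) (b j - m)

/-- If the next minimum is not attained in a convex piece of the feasible set, the nearest point of
the closure of the piece takes its place. It may be covered already, but its half-space is needed,
and it is not nearer to the mean than the points found before. Finitely many such points cover the
feasible set. -/
theorem exists_finset_cover {m : EuclideanSpace ℝ (Fin d)} {S : Matrix (Fin d) (Fin d) ℝ}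
    (hS : S.PosDef) {N : ℕ} {K : Fin N → Set (EuclideanSpace ℝ (Fin d))}
    (hK : ∀ l, Convex ℝ (K l)) (hKc : ∀ l, IsClosed (K l))
    {a : ℕ → EuclideanSpace ℝ (Fin d)} {n : ℕ}
    (ha : ∀ j < n, IsNextPoint m S (⋃ l, K l) a j) :
    ∃ Z : Finset (EuclideanSpace ℝ (Fin d)), Z.card ≤ N ∧
      (∀ z ∈ Z, z ∈ ⋃ l, K l) ∧
      (∀ z ∈ Z, ∀ i < n, precForm S (a i - m) (a i - m) ≤ precForm S (z - m) (z - m)) ∧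
      (∀ z ∈ Z, ∀ i < n, a i ≠ z) ∧
      ∀ x ∈ feasible m S (⋃ l, K l) a n, ∃ z ∈ Z, 0 ≤ precForm S (z - m) (x - z) := by
  classical
  set E := ⋃ l, K l with hE
  set G : Fin N → Set (EuclideanSpace ℝ (Fin d)) := fun l => feasible m S E a n ∩ K l with hG
  have hz : ∀ l, ∃ z, (G l).Nonempty → z ∈ closure (G l) ∧
      ∀ x ∈ closure (G l), precForm S (z - m) (z - m) ≤ precForm S (x - m) (x - m) := by
    intro l
    by_cases h : (G l).Nonempty
    · obtain ⟨z, hz, hz2⟩ := exists_minimizer hS m isClosed_closure h.closure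
      exact ⟨z, fun _ => ⟨hz, hz2⟩⟩
    · exact ⟨0, fun h' => (h h').elim⟩
  choose z hz using hz
  have hhalf : ∀ l, (G l).Nonempty → ∀ x ∈ G l, 0 ≤ precForm S (z l - m) (x - z l) :=
    fun l hl x hx => precForm_nonneg_of_minimizer hS
      (convex_feasible_inter (hK l) (subset_iUnion K l) a n).closure (hz l hl).1 (hz l hl).2
      (subset_closure hx)
  refine ⟨(Finset.univ.filter fun l => (G l).Nonempty).image z, ?_, ?_, ?_, ?_, ?_⟩
  · refine Finset.card_image_le.trans ((Finset.card_filter_le _ _).trans ?_)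
    simp
  all_goals simp only [Finset.mem_image, Finset.mem_filter, Finset.mem_univ, true_and,
    forall_exists_index, and_imp, forall_apply_eq_imp_iff₂]
  · intro l hl
    exact mem_iUnion.2 ⟨l, closure_minimal inter_subset_right (hKc l) (hz l hl).1⟩
  · intro l hl i hi
    have hsub : closure (G l) ⊆
        {x | precForm S (a i - m) (a i - m) ≤ precForm S (x - m) (x - m)} :=
      closure_minimal (fun x hx => (ha i hi).2 x (feasible_antitone m S E a hi.le hx.1))
        (isClosed_le continuous_const (continuous_precForm_sub_self S m))
    exact hsub (hz l hl).1
  · intro l hl i hi heq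
    obtain ⟨y, hy⟩ := hl
    have h1 := hhalf l ⟨y, hy⟩ y hy
    have h2 := hy.1.2 i hi
    rw [heq] at h2
    linarith
  · intro x hx
    obtain ⟨l, hl⟩ := mem_iUnion.1 hx.1
    exact ⟨z l, ⟨l, ⟨x, hx, hl⟩, rfl⟩, hhalf l ⟨x, hx, hl⟩ x ⟨hx, hl⟩⟩

theorem exists_minimal_finset_cover {α β : Type*} (R : α → β → Prop) (F : Set β) (Z : Finset α)
    (h : ∀ x ∈ F, ∃ z ∈ Z, R z x) :
    ∃ Z' ⊆ Z, (∀ x ∈ F, ∃ z ∈ Z', R z x) ∧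
      ∀ z ∈ Z', ∃ x ∈ F, ∀ w ∈ Z', w ≠ z → ¬ R w x := by
  classical
  obtain ⟨Z', hZ', hmin⟩ := exists_minimal_le_of_wellFoundedLT
    (fun Y : Finset α => ∀ x ∈ F, ∃ z ∈ Y, R z x) Z h
  refine ⟨Z', hZ', hmin.1, fun z hz => ?_⟩
  by_contra! hcon
  have h2 : Z' ≤ Z'.erase z := by
    refine hmin.2 (fun x hx => ?_) (Finset.erase_subset _ _)
    obtain ⟨w, hw, hwz, hR⟩ := hcon x hx
    exact ⟨w, Finset.mem_erase.2 ⟨hwz, hw⟩, hR⟩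
  exact Finset.notMem_erase z Z' (h2 hz)

/-- Every finite set can be enumerated in the order of a given real function. -/
theorem exists_sorted_enumeration {α : Type*} (Z : Finset α) (q : α → ℝ) :
    ∃ e : Fin Z.card → α, Function.Injective e ∧ (∀ z, z ∈ Z ↔ ∃ i, e i = z) ∧
      Monotone (q ∘ e) := by
  let e₀ : Fin Z.card → α := fun i => (Z.equivFin.symm i : α)
  let σ := Tuple.sort (q ∘ e₀)
  refine ⟨e₀ ∘ σ, ?_, fun z => ⟨fun hz => ?_, ?_⟩, ?_⟩
  · exact (Subtype.val_injective.comp Z.equivFin.symm.injective).comp σ.injective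
  · exact ⟨σ.symm (Z.equivFin ⟨z, hz⟩), by simp [e₀]⟩
  · rintro ⟨i, rfl⟩
    exact (Z.equivFin.symm (σ i)).2
  · exact Tuple.monotone_sort (q ∘ e₀)

/-- The points found by the search can be completed to a minimal ordered cover. -/
theorem exists_completion {m : EuclideanSpace ℝ (Fin d)} {S : Matrix (Fin d) (Fin d) ℝ}
    (hS : S.PosDef) {N : ℕ} {K : Fin N → Set (EuclideanSpace ℝ (Fin d))}
    (hK : ∀ l, Convex ℝ (K l)) (hKc : ∀ l, IsClosed (K l))
    {a : ℕ → EuclideanSpace ℝ (Fin d)} {n : ℕ}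
    (ha : ∀ j < n, IsNextPoint m S (⋃ l, K l) a j) :
    ∃ (r : ℕ) (b : ℕ → EuclideanSpace ℝ (Fin d)), n ≤ r ∧ r ≤ 2 * N ∧ (∀ i < n, b i = a i) ∧
      IsOrderedCover m S (⋃ l, K l) b r ∧ (feasible m S (⋃ l, K l) a n = ∅ → r = n) := by
  obtain ⟨Z₀, hcard, hmem, hle, hne, hcov⟩ := exists_finset_cover hS hK hKc ha
  obtain ⟨Z, hZ, hcov, hmin⟩ := exists_minimal_finset_cover
    (fun z x => 0 ≤ precForm S (z - m) (x - z)) (feasible m S (⋃ l, K l) a n) Z₀ hcov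
  obtain ⟨e, hinj, hrange, hmono⟩ := exists_sorted_enumeration Z
    fun z => precForm S (z - m) (z - m)
  have hn : n ≤ N := search_length_le hS hK ha
  have hZc : Z.card ≤ N := (Finset.card_le_card hZ).trans hcard
  set b : ℕ → EuclideanSpace ℝ (Fin d) := fun i =>
    if i < n then a i else if h : i - n < Z.card then e ⟨i - n, h⟩ else 0 with hb
  have hb1 : ∀ i < n, b i = a i := fun i hi => if_pos hi
  have hb2 : ∀ i : Fin Z.card, b (n + i) = e i := by
    intro i
    simp [hb]
  have hcase : ∀ i < n + Z.card, i < n ∨ ∃ l : Fin Z.card, i = n + l := by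
    intro i hi
    by_cases h : i < n
    · exact Or.inl h
    · exact Or.inr ⟨⟨i - n, by omega⟩, by simp; omega⟩
  have heZ : ∀ i, e i ∈ Z₀ := fun i => hZ ((hrange _).2 ⟨i, rfl⟩)
  refine ⟨n + Z.card, b, Nat.le_add_right _ _, by omega, hb1, ⟨?_, ?_, ?_, ?_⟩, ?_⟩
  · intro i hi
    rcases hcase i hi with h | ⟨l, rfl⟩
    · rw [hb1 i h]
      exact (ha i h).1.1
    · rw [hb2]
      exact hmem _ (heZ l)
  · intro x hx
    by_cases hxf : x ∈ feasible m S (⋃ l, K l) a n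
    · obtain ⟨z, hz, hz2⟩ := hcov x hxf
      obtain ⟨l, rfl⟩ := (hrange z).1 hz
      exact ⟨n + l, by omega, by rwa [hb2]⟩
    · have : ∃ i < n, 0 ≤ precForm S (a i - m) (x - a i) := by
        by_contra! hcon
        exact hxf ⟨hx, hcon⟩
      obtain ⟨i, hi, h⟩ := this
      exact ⟨i, by omega, by rwa [hb1 i hi]⟩
  · intro i hi
    rcases hcase i hi with h | ⟨l, rfl⟩
    · -- a point found by the search is covered by no other half-space
      refine ⟨a i, (ha i h).1.1, fun j hj hji => ?_⟩
      by_contra! hcon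
      rcases hcase j hj with h' | ⟨l', rfl⟩
      · rw [hb1 j h'] at hcon
        rcases lt_or_gt_of_ne hji with hlt | hlt
        · have := (ha i h).1.2 j hlt
          linarith
        · have heq := eq_of_precForm_nonneg hS ((ha i h).le (ha j h') hlt.le) hcon
          have := (ha j h').1.2 i hlt
          rw [heq, sub_self, precForm_zero_right] at this
          exact lt_irrefl 0 this
      · rw [hb2] at hcon
        exact hne _ (heZ l') i h (eq_of_precForm_nonneg hS (hle _ (heZ l') i h) hcon)
    · obtain ⟨x, hx, hx2⟩ := hmin (e l) ((hrange _).2 ⟨l, rfl⟩)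
      refine ⟨x, hx.1, fun j hj hji => ?_⟩
      rcases hcase j hj with h' | ⟨l', rfl⟩
      · rw [hb1 j h']
        exact hx.2 j h'
      · rw [hb2]
        refine not_le.1 (hx2 (e l') ((hrange _).2 ⟨l', rfl⟩) fun h => hji ?_)
        rw [hinj h]
  · intro i j hij hj
    rcases hcase j hj with h' | ⟨l', rfl⟩
    · have h : i < n := by omega
      rw [hb1 i h, hb1 j h']
      exact (ha i h).le (ha j h') hij
    · rcases hcase i (by omega) with h | ⟨l, rfl⟩
      · rw [hb1 i h, hb2]
        exact hle _ (heZ l') i h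
      · rw [hb2, hb2]
        exact hmono (Fin.le_def.2 (by omega))
  · intro hemp
    have : Z = ∅ := by
      by_contra hne'
      obtain ⟨z, hz⟩ := Finset.nonempty_iff_ne_empty.2 hne'
      obtain ⟨x, hx, -⟩ := hmin z hz
      rw [hemp] at hx
      exact hx
    simp [this]

/-- The stopped search terminates, and its points are the beginning of a minimal ordered cover. -/
theorem exists_stop_and_cover {m : EuclideanSpace ℝ (Fin d)} {S : Matrix (Fin d) (Fin d) ℝ}
    (hS : S.PosDef) {N : ℕ} {K : Fin N → Set (EuclideanSpace ℝ (Fin d))}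
    (hK : ∀ l, Convex ℝ (K l)) (hKc : ∀ l, IsClosed (K l)) {C : ℝ}
    {E : Set (EuclideanSpace ℝ (Fin d))} (hE : E = ⋃ l, K l) (hne : E.Nonempty)
    {a : ℕ → EuclideanSpace ℝ (Fin d)} (ha : IsStoppedSearch m S C E a) :
    ∃ (k r : ℕ) (b : ℕ → EuclideanSpace ℝ (Fin d)),
      StopsAt m S C E a k ∧ 1 ≤ k ∧ k ≤ r ∧ (∀ i, i ≤ k → i < r → b i = a i) ∧
      (IsFullSearch m S E a → ∀ i, i < r → b i = a i) ∧
      r ≤ 2 * N ∧ IsOrderedCover m S E b r ∧ (k < r → BreaksAt m S C a k) ∧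
      ∀ j < k, IsNextPoint m S E a j := by
  classical
  subst hE
  set E := ⋃ l, K l
  have hex : ∃ j, feasible m S E a j = ∅ ∨ BreaksAt m S C a j := by
    by_contra! hcon
    have := search_length_le hS hK (a := a) (m := m) (n := N + 1) fun j _ =>
      ha j (fun i _ => (hcon i).2) (hcon j).1
    omega
  obtain ⟨k, hk, hlt⟩ : ∃ k, (feasible m S E a k = ∅ ∨ BreaksAt m S C a k) ∧
      ∀ i < k, (feasible m S E a i).Nonempty ∧ ¬ BreaksAt m S C a i := by
    refine ⟨Nat.find hex, Nat.find_spec hex, fun i hi => ?_⟩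
    have := Nat.find_min hex hi
    push Not at this
    exact this
  have hnext : ∀ j < k, IsNextPoint m S E a j := fun j hj =>
    ha j (fun i hi => (hlt i (hi.trans hj)).2) (hlt j hj).1
  have hk1 : 1 ≤ k := by
    rcases Nat.eq_zero_or_pos k with rfl | h
    · rcases hk with h | h
      · obtain ⟨x, hx⟩ := hne
        have : x ∈ feasible m S E a 0 := ⟨hx, fun i hi => (Nat.not_lt_zero i hi).elim⟩
        rw [h] at this
        exact this.elim
      · exact absurd h.1 (lt_irrefl 0)
    · exact h
  by_cases hfull : IsFullSearch m S E a
  · have hex2 : ∃ j, feasible m S E a j = ∅ := by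
      by_contra! hcon
      have := search_length_le hS hK (a := a) (m := m) (n := N + 1) fun j _ => hfull j (hcon j)
      omega
    obtain ⟨n, hn, hnlt⟩ : ∃ n, feasible m S E a n = ∅ ∧
        ∀ i < n, (feasible m S E a i).Nonempty :=
      ⟨Nat.find hex2, Nat.find_spec hex2, fun i hi =>
        nonempty_iff_ne_empty.2 (Nat.find_min hex2 hi)⟩
    obtain ⟨r, b, -, hr2, hb, hcov, hr⟩ :=
      exists_completion hS hK hKc (n := n) fun j hj => hfull j (hnlt j hj)
    obtain rfl := hr hn
    refine ⟨k, r, b, ⟨hlt, hk⟩, hk1, ?_, fun i _ hi => hb i hi, fun _ i hi => hb i hi, hr2, hcov,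
      fun hkr => ?_, hnext⟩
    · by_contra! h
      exact (hlt r h).1.ne_empty hn
    · exact hk.resolve_left (hnlt k hkr).ne_empty
  by_cases hemp : feasible m S E a k = ∅
  · obtain ⟨r, b, -, hr2, hb, hcov, hr⟩ := exists_completion hS hK hKc hnext
    obtain rfl := hr hemp
    exact ⟨r, r, b, ⟨hlt, hk⟩, hk1, le_rfl, fun i _ hi => hb i hi, fun _ i hi => hb i hi, hr2,
      hcov, fun h => absurd h (lt_irrefl r), hnext⟩
  · have hbreak := hk.resolve_left hemp
    have hk' : IsNextPoint m S E a k :=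
      ha k (fun i hi => (hlt i hi).2) (nonempty_iff_ne_empty.2 hemp)
    obtain ⟨r, b, hkr, hr2, hb, hcov, -⟩ :=
      exists_completion hS hK hKc (n := k + 1) fun j hj =>
        (Nat.lt_succ_iff_lt_or_eq.1 hj).elim (hnext j) fun h => h ▸ hk'
    exact ⟨k, r, b, ⟨hlt, hk⟩, hk1, by omega, fun i hi _ => hb i (by omega),
      fun h => (hfull h).elim, hr2, hcov, fun _ => hbreak, hnext⟩

/-! ### Polyhedra and piecewise linear functions -/

theorem IsClosedPolyhedron.convex {D : Set (EuclideanSpace ℝ (Fin d))}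
    (hD : IsClosedPolyhedron D) : Convex ℝ D := by
  obtain ⟨n, c, β, rfl⟩ := hD
  rw [ofPred_forall]
  exact convex_iInter fun i => convex_halfSpace_le (innerₛₗ ℝ (c i)).isLinear (β i)

theorem IsClosedPolyhedron.isClosed {D : Set (EuclideanSpace ℝ (Fin d))}
    (hD : IsClosedPolyhedron D) : IsClosed D := by
  obtain ⟨n, c, β, rfl⟩ := hD
  rw [ofPred_forall]
  exact isClosed_iInter fun i => isClosed_le (by fun_prop) continuous_const

/-- A linear functional that is unbounded above on a polyhedron increases along one of its
recession directions. The induction adds one constraint at a time; if the direction `w` for the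
other constraints violates the new one, the problem is projected along `w` to the hyperplane on
which the new constraint vanishes. -/
theorem exists_recession_direction {V : Type*} [AddCommGroup V] [Module ℝ V] (n : ℕ)
    (c : Fin n → V →ₗ[ℝ] ℝ) (β : Fin n → ℝ) (u : V →ₗ[ℝ] ℝ)
    (h : ∀ M : ℝ, ∃ x, (∀ i, c i x ≤ β i) ∧ M < u x) :
    ∃ w, (∀ i, c i w ≤ 0) ∧ 0 < u w := by
  induction n generalizing u with
  | zero =>
    obtain ⟨x, -, hx⟩ := h 0
    exact ⟨x, fun i => i.elim0, hx⟩
  | succ n ih =>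
    obtain ⟨w, hw, huw⟩ := ih (fun i => c i.succ) (fun i => β i.succ) u fun M => by
      obtain ⟨x, hx, hM⟩ := h M
      exact ⟨x, fun i => hx i.succ, hM⟩
    rcases le_or_gt (c 0 w) 0 with h0 | h0
    · exact ⟨w, Fin.cases h0 hw, huw⟩
    let π : V →ₗ[ℝ] V := LinearMap.id - ((c 0 w)⁻¹ • (c 0)).smulRight w
    have hπ : ∀ x, π x = x - ((c 0 w)⁻¹ * c 0 x) • w := fun x => rfl
    obtain ⟨y, hy, huy⟩ := ih (fun i => (c i.succ).comp π)
      (fun i => β i.succ - (c 0 w)⁻¹ * β 0 * c i.succ w) (u.comp π) fun M => by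
        obtain ⟨x, hx, hM⟩ := h (M + (c 0 w)⁻¹ * β 0 * u w)
        have hle : (c 0 w)⁻¹ * c 0 x ≤ (c 0 w)⁻¹ * β 0 :=
          mul_le_mul_of_nonneg_left (hx 0) (inv_pos.2 h0).le
        refine ⟨x, fun i => ?_, ?_⟩
        · rw [LinearMap.comp_apply, hπ, map_sub, map_smul, smul_eq_mul]
          have h1 := hx i.succ
          have h2 := mul_le_mul_of_nonpos_right hle (hw i)
          linarith
        · rw [LinearMap.comp_apply, hπ, map_sub, map_smul, smul_eq_mul]
          have h2 := mul_le_mul_of_nonneg_right hle huw.le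
          linarith
    refine ⟨π y, Fin.cases ?_ hy, huy⟩
    rw [hπ, map_sub, map_smul, smul_eq_mul]
    field_simp
    simp

/-- The part of a piece of the domain on which the affine function `⟨u, x⟩ + v` is at least
`γ`. -/
def levelPiece (D : Set (EuclideanSpace ℝ (Fin d))) (u : EuclideanSpace ℝ (Fin d)) (v γ : ℝ) :
    Set (EuclideanSpace ℝ (Fin d)) :=
  D ∩ {x | γ ≤ inner ℝ u x + v}

theorem IsClosedPolyhedron.convex_levelPiece {D : Set (EuclideanSpace ℝ (Fin d))}
    (hD : IsClosedPolyhedron D) (u : EuclideanSpace ℝ (Fin d)) (v γ : ℝ) :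
    Convex ℝ (levelPiece D u v γ) := by
  have h := convex_halfSpace_ge (innerₛₗ ℝ u).isLinear (γ - v)
  simp only [innerₛₗ_apply_apply, sub_le_iff_le_add] at h
  exact hD.convex.inter h

theorem IsClosedPolyhedron.isClosed_levelPiece {D : Set (EuclideanSpace ℝ (Fin d))}
    (hD : IsClosedPolyhedron D) (u : EuclideanSpace ℝ (Fin d)) (v γ : ℝ) :
    IsClosed (levelPiece D u v γ) :=
  hD.isClosed.inter (isClosed_le continuous_const (by fun_prop))

theorem rareSet_eq_iUnion {g : EuclideanSpace ℝ (Fin d) → ℝ} {N : ℕ}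
    {D : Fin N → Set (EuclideanSpace ℝ (Fin d))} {u : Fin N → EuclideanSpace ℝ (Fin d)}
    {v : Fin N → ℝ} (hcov : ⋃ j, D j = univ) (hg : ∀ j, ∀ x ∈ D j, g x = inner ℝ (u j) x + v j)
    (γ : ℝ) : rareSet g γ = ⋃ j, levelPiece (D j) (u j) (v j) γ := by
  ext x
  simp only [rareSet, levelPiece, mem_ofPred_eq, mem_iUnion, mem_inter_iff]
  constructor
  · intro hx
    obtain ⟨j, hj⟩ := mem_iUnion.1 (hcov ▸ mem_univ x)
    exact ⟨j, hj, hg j x hj ▸ hx⟩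
  · rintro ⟨j, hj, hx⟩
    rwa [hg j x hj]

theorem IsPiecewiseLinear.continuous {g : EuclideanSpace ℝ (Fin d) → ℝ}
    (hg : IsPiecewiseLinear g) : Continuous g := by
  obtain ⟨N, D, hD, hcov, hlin⟩ := hg
  refine (locallyFinite_of_finite D).continuous hcov (fun j => (hD j).isClosed) fun j => ?_
  obtain ⟨u, v, h⟩ := hlin j
  exact ContinuousOn.congr (f := fun x => inner ℝ u x + v) (by fun_prop) h

theorem IsPiecewiseLinear.isClosed_rareSet {g : EuclideanSpace ℝ (Fin d) → ℝ}
    (hg : IsPiecewiseLinear g) (γ : ℝ) : IsClosed (rareSet g γ) :=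
  isClosed_le continuous_const hg.continuous

/-- In a finite closed cover the members with empty interior can be dropped. -/
theorem exists_mem_with_interior {X : Type*} [TopologicalSpace X] [BaireSpace X] {N : ℕ}
    {D : Fin N → Set X} (hD : ∀ j, IsClosed (D j)) (hcov : ⋃ j, D j = univ) (x : X) :
    ∃ j, x ∈ D j ∧ (interior (D j)).Nonempty := by
  classical
  by_contra! hcon
  have hopen : IsOpen (⋂ j : {j // (interior (D j)).Nonempty}, (D j)ᶜ) :=
    isOpen_iInter_of_finite fun j => (hD j).isOpen_compl
  have hdense : Dense (⋂ j : {j // ¬ (interior (D j)).Nonempty}, (D j)ᶜ) :=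
    dense_iInter_of_isOpen (fun j => (hD j).isOpen_compl) fun j =>
      interior_eq_empty_iff_dense_compl.1 (not_nonempty_iff_eq_empty.1 j.2)
  have hx : x ∈ ⋂ j : {j // (interior (D j)).Nonempty}, (D j)ᶜ :=
    mem_iInter.2 fun j hxj => j.2.ne_empty (hcon j hxj)
  obtain ⟨y, hy1, hy2⟩ := hdense.inter_open_nonempty _ hopen ⟨x, hx⟩
  obtain ⟨j, hj⟩ := mem_iUnion.1 (hcov ▸ mem_univ y)
  by_cases h : (interior (D j)).Nonempty
  · exact mem_iInter.1 hy1 ⟨j, h⟩ hj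
  · exact mem_iInter.1 hy2 ⟨j, h⟩ hj

/-! ### Probability of a polyhedral piece -/

/-- From any point `a` of a convex set with a recession direction `w` along which `⟨u, ·⟩`
increases, a small step towards an inner ball, corrected along `w`, leads to a ball of fixed radius
on which `⟨u, ·⟩` is at least its value at `a`. The length of the step is a small multiple of the
distance of `a` from `m`. -/
theorem exists_ball_near {D : Set (EuclideanSpace ℝ (Fin d))} (hD : Convex ℝ D)
    (m : EuclideanSpace ℝ (Fin d)) {x₀ u w : EuclideanSpace ℝ (Fin d)} {ρ : ℝ} (hρ : 0 < ρ)
    (hball : Metric.ball x₀ ρ ⊆ D)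
    (hw : ∀ x ∈ D, ∀ s : ℝ, 0 ≤ s → x + s • w ∈ D) (huw : 0 < (inner ℝ u w : ℝ)) :
    ∃ L : ℝ, 0 ≤ L ∧ ∀ t ∈ Ioc (0 : ℝ) 1, ∀ a ∈ D, ∃ c, ∀ z ∈ Metric.ball c (t * ρ),
      z ∈ D ∧ (inner ℝ u a : ℝ) ≤ inner ℝ u z ∧ ‖z - a‖ ≤ t * (L * (‖a - m‖ + 1)) := by
  refine ⟨(1 + (‖x₀‖ + ρ + ‖m‖)) * (1 + ‖u‖ * ‖w‖ / inner ℝ u w), by positivity, ?_⟩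
  intro t ht a ha
  have ht0 := ht.1
  set B : ℝ := ‖a‖ + ‖x₀‖ + ρ with hB
  have hB0 : 0 ≤ B := by positivity
  set s : ℝ := t * (‖u‖ * B / inner ℝ u w) with hs
  have hs0 : 0 ≤ s := by positivity
  refine ⟨(1 - t) • a + t • x₀ + s • w, fun z hz => ?_⟩
  obtain ⟨y, hy⟩ : ∃ y, z = (1 - t) • a + t • y + s • w :=
    ⟨t⁻¹ • (z - (1 - t) • a - s • w), by rw [smul_inv_smul₀ ht0.ne']; abel⟩
  have hyball : y ∈ Metric.ball x₀ ρ := by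
    rw [Metric.mem_ball, dist_eq_norm] at hz ⊢
    have h1 : z - ((1 - t) • a + t • x₀ + s • w) = t • (y - x₀) := by
      rw [hy, smul_sub]; abel
    rw [h1, norm_smul, Real.norm_of_nonneg ht0.le] at hz
    exact lt_of_mul_lt_mul_left hz ht0.le
  have hynorm : ‖y - a‖ ≤ B := by
    have h1 : ‖y - x₀‖ < ρ := by rwa [← dist_eq_norm]
    have h2 : y - a = (y - x₀) + (x₀ - a) := by abel
    calc ‖y - a‖ ≤ ‖y - x₀‖ + ‖x₀ - a‖ := h2 ▸ norm_add_le _ _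
      _ ≤ ρ + (‖x₀‖ + ‖a‖) := add_le_add h1.le (norm_sub_le _ _)
      _ = B := by rw [hB]; ring
  have hza : z - a = t • (y - a) + s • w := by
    rw [hy, sub_smul, one_smul, smul_sub]; abel
  refine ⟨?_, ?_, ?_⟩
  · rw [hy]
    exact hw _ (hD ha (hball hyball) (by linarith [ht.2]) ht0.le (by ring)) s hs0
  · have h1 : (inner ℝ u z : ℝ) = inner ℝ u a + (t * inner ℝ u (y - a) + s * inner ℝ u w) := by
      rw [← real_inner_smul_right, ← real_inner_smul_right, ← inner_add_right, ← hza,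
        ← inner_add_right, add_sub_cancel]
    have h2 : s * inner ℝ u w = t * (‖u‖ * B) := by
      rw [hs]; field_simp
    have h3 : -(‖u‖ * B) ≤ inner ℝ u (y - a) := by
      have := neg_le_of_abs_le (abs_real_inner_le_norm u (y - a))
      have := mul_le_mul_of_nonneg_left hynorm (norm_nonneg u)
      linarith
    have := mul_le_mul_of_nonneg_left h3 ht0.le
    rw [h1, h2]
    linarith
  · have h1 : B ≤ (1 + (‖x₀‖ + ρ + ‖m‖)) * (‖a - m‖ + 1) := by
      have h2 : ‖a‖ ≤ ‖a - m‖ + ‖m‖ := by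
        simpa using norm_add_le (a - m) m
      have h3 : 0 ≤ (‖x₀‖ + ρ + ‖m‖) * ‖a - m‖ := by positivity
      rw [hB]
      linarith
    calc ‖z - a‖ ≤ ‖t • (y - a)‖ + ‖s • w‖ := hza ▸ norm_add_le _ _
      _ = t * ‖y - a‖ + s * ‖w‖ := by
        rw [norm_smul, norm_smul, Real.norm_of_nonneg ht0.le, Real.norm_of_nonneg hs0]
      _ ≤ t * B + s * ‖w‖ := by gcongr
      _ = t * ((1 + ‖u‖ * ‖w‖ / inner ℝ u w) * B) := by rw [hs]; ring
      _ ≤ t * ((1 + ‖u‖ * ‖w‖ / inner ℝ u w) *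
          ((1 + (‖x₀‖ + ρ + ‖m‖)) * (‖a - m‖ + 1))) := by gcongr
      _ = _ := by ring

/-- Lower bound for the Gaussian probability of a set that contains a ball. -/
theorem le_lawOf_gaussianDensity_of_ball {S : Matrix (Fin d) (Fin d) ℝ} (hS : S.PosDef)
    {r : ℝ} (hr : 0 < r) :
    ∃ κ : ℝ, 0 < κ ∧ ∀ (m c : EuclideanSpace ℝ (Fin d)) (A : Set (EuclideanSpace ℝ (Fin d)))
      (Q : ℝ), Metric.ball c r ⊆ A →
      (∀ z ∈ Metric.ball c r, precForm S (z - m) (z - m) ≤ Q) →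
      ENNReal.ofReal (κ * Real.exp (-(1 / 2) * Q)) ≤ lawOf (gaussianDensity m S) A := by
  have hvol : 0 < (volume (Metric.ball (0 : EuclideanSpace ℝ (Fin d)) r)).toReal :=
    ENNReal.toReal_pos (Metric.measure_ball_pos _ _ hr).ne' measure_ball_lt_top.ne
  have hc0 := gaussianConst_pos hS
  refine ⟨(volume (Metric.ball (0 : EuclideanSpace ℝ (Fin d)) r)).toReal * gaussianConst S,
    mul_pos hvol hc0, fun m c A Q hA hQ => ?_⟩
  calc ENNReal.ofReal ((volume (Metric.ball (0 : EuclideanSpace ℝ (Fin d)) r)).toReal *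
        gaussianConst S * Real.exp (-(1 / 2) * Q))
      = ENNReal.ofReal (gaussianConst S * Real.exp (-(1 / 2) * Q)) *
          volume (Metric.ball c r) := by
        rw [Measure.addHaar_ball_center volume c, mul_assoc, mul_comm,
          ENNReal.ofReal_mul (by positivity), ENNReal.ofReal_toReal measure_ball_lt_top.ne]
    _ = ∫⁻ _ in Metric.ball c r, ENNReal.ofReal (gaussianConst S * Real.exp (-(1 / 2) * Q)) := by
        rw [setLIntegral_const]
    _ ≤ ∫⁻ z in Metric.ball c r, ENNReal.ofReal (gaussianDensity m S z) := by
        refine setLIntegral_mono (measurable_ofReal_gaussianDensity m S) fun z hz => ?_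
        refine ENNReal.ofReal_le_ofReal ?_
        rw [gaussianDensity_eq]
        have := hQ z hz
        exact mul_le_mul_of_nonneg_left (Real.exp_le_exp.2 (by linarith)) hc0.le
    _ = lawOf (gaussianDensity m S) (Metric.ball c r) := by
        rw [lawOf, withDensity_apply _ measurableSet_ball]
    _ ≤ _ := measure_mono hA

/-- On the logarithmic scale, the probability of the part of a full-dimensional piece above the
level of one of its points `a` is at least `exp (-q(a) / 2)`. -/
theorem le_lawOf_gaussianDensity_piece {S : Matrix (Fin d) (Fin d) ℝ} (hS : S.PosDef)
    (m : EuclideanSpace ℝ (Fin d)) {D : Set (EuclideanSpace ℝ (Fin d))} (hD : Convex ℝ D)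
    (hint : (interior D).Nonempty) {u w : EuclideanSpace ℝ (Fin d)}
    (hw : ∀ x ∈ D, ∀ s : ℝ, 0 ≤ s → x + s • w ∈ D) (huw : 0 < (inner ℝ u w : ℝ))
    {ε : ℝ} (hε : 0 < ε) :
    ∃ κ : ℝ, 0 < κ ∧ ∀ a ∈ D, 1 ≤ precForm S (a - m) (a - m) →
      ENNReal.ofReal (κ * Real.exp (-(1 / 2) * ((1 + ε) * precForm S (a - m) (a - m)))) ≤
        lawOf (gaussianDensity m S) (D ∩ {x | (inner ℝ u a : ℝ) ≤ inner ℝ u x}) := by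
  obtain ⟨x₀, hx₀⟩ := hint
  obtain ⟨ρ, hρ, hball⟩ := Metric.isOpen_iff.1 isOpen_interior x₀ hx₀
  obtain ⟨T, hT, -⟩ := exists_whitening hS
  obtain ⟨L, hL, hnear⟩ := exists_ball_near hD m hρ (hball.trans interior_subset) hw huw
  set T' : EuclideanSpace ℝ (Fin d) →L[ℝ] EuclideanSpace ℝ (Fin d) :=
    T.toContinuousLinearMap
  set T'' : EuclideanSpace ℝ (Fin d) →L[ℝ] EuclideanSpace ℝ (Fin d) :=
    T.symm.toContinuousLinearMap
  set M : ℝ := ‖T'‖ * (L * (‖T''‖ + 1)) with hM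
  have hM0 : 0 ≤ M := by positivity
  -- for this step size `(1 + t * M) ^ 2 ≤ 1 + ε`
  set t : ℝ := min 1 (ε / (2 * M + M ^ 2 + 1)) with ht
  have ht0 : 0 < t := lt_min one_pos (by positivity)
  have ht1 : t ≤ 1 := min_le_left _ _
  have htM : (1 + t * M) ^ 2 ≤ 1 + ε := by
    have h1 : t * (2 * M + M ^ 2 + 1) ≤ ε := by
      rw [← le_div_iff₀ (by positivity)]
      exact min_le_right _ _
    have h2 : t * t * M ^ 2 ≤ 1 * t * M ^ 2 := by gcongr
    nlinarith
  obtain ⟨κ, hκ, hκ2⟩ := le_lawOf_gaussianDensity_of_ball hS (mul_pos ht0 hρ)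
  refine ⟨κ, hκ, fun a ha hq => ?_⟩
  obtain ⟨c, hc⟩ := hnear t ⟨ht0, ht1⟩ a ha
  refine hκ2 m c _ _ (fun z hz => ⟨(hc z hz).1, (hc z hz).2.1⟩) fun z hz => ?_
  rw [hT, real_inner_self_eq_norm_sq] at hq
  rw [hT, hT, real_inner_self_eq_norm_sq, real_inner_self_eq_norm_sq]
  have hR : 1 ≤ ‖T (a - m)‖ := by
    by_contra! h
    have := pow_lt_one₀ (norm_nonneg _) h two_ne_zero
    linarith
  have h1 : ‖a - m‖ ≤ ‖T''‖ * ‖T (a - m)‖ := by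
    simpa [T''] using T''.le_opNorm (T (a - m))
  have h2 : ‖T (z - m)‖ ≤ (1 + t * M) * ‖T (a - m)‖ := by
    calc ‖T (z - m)‖ = ‖T (a - m) + T' (z - a)‖ := by
          rw [show T' (z - a) = T (z - a) from rfl, ← map_add]
          congr 2
          abel
      _ ≤ ‖T (a - m)‖ + ‖T'‖ * ‖z - a‖ := (norm_add_le _ _).trans (by gcongr; exact T'.le_opNorm _)
      _ ≤ ‖T (a - m)‖ + ‖T'‖ * (t * (L * (‖T''‖ * ‖T (a - m)‖ + 1 * ‖T (a - m)‖))) := by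
          have := (hc z hz).2.2
          rw [one_mul]
          gcongr
          refine this.trans ?_
          gcongr
      _ = _ := by rw [hM]; ring
  calc ‖T (z - m)‖ ^ 2 ≤ ((1 + t * M) * ‖T (a - m)‖) ^ 2 := by gcongr
    _ = (1 + t * M) ^ 2 * ‖T (a - m)‖ ^ 2 := by ring
    _ ≤ _ := by gcongr

/-- At high levels every point `a` of the rare-event set lies in a piece whose probability is, on
the logarithmic scale, at least `exp (-q(a) / 2)`: pieces on which the affine function is bounded
have disappeared, and pieces with empty interior are not needed. -/
theorem exists_piece_lower_bound {S : Matrix (Fin d) (Fin d) ℝ} (hS : S.PosDef)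
    (m : EuclideanSpace ℝ (Fin d)) {N : ℕ} {D : Fin N → Set (EuclideanSpace ℝ (Fin d))}
    (hD : ∀ j, IsClosedPolyhedron (D j)) (hcov : ⋃ j, D j = univ)
    {g : EuclideanSpace ℝ (Fin d) → ℝ} {u : Fin N → EuclideanSpace ℝ (Fin d)}
    {v : Fin N → ℝ} (hg : ∀ j, ∀ x ∈ D j, g x = inner ℝ (u j) x + v j) {ε : ℝ} (hε : 0 < ε) :
    ∃ κ : ℝ, 0 < κ ∧ ∀ᶠ γ in atTop, ∀ a ∈ rareSet g γ, 1 ≤ precForm S (a - m) (a - m) →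
      ∃ j, a ∈ levelPiece (D j) (u j) (v j) γ ∧
        ENNReal.ofReal (κ * Real.exp (-(1 / 2) * ((1 + ε) * precForm S (a - m) (a - m)))) ≤
          lawOf (gaussianDensity m S) (levelPiece (D j) (u j) (v j) γ) := by
  have hpiece : ∀ j, ∃ κ : ℝ, 0 < κ ∧ ((interior (D j)).Nonempty → ∀ᶠ γ in atTop,
      ∀ a ∈ levelPiece (D j) (u j) (v j) γ, 1 ≤ precForm S (a - m) (a - m) →
        ENNReal.ofReal (κ * Real.exp (-(1 / 2) * ((1 + ε) * precForm S (a - m) (a - m)))) ≤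
          lawOf (gaussianDensity m S) (levelPiece (D j) (u j) (v j) γ)) := by
    intro j
    by_cases hint : (interior (D j)).Nonempty
    · by_cases hbdd : ∃ M : ℝ, ∀ x ∈ D j, (inner ℝ (u j) x : ℝ) ≤ M
      · obtain ⟨M, hM⟩ := hbdd
        refine ⟨1, one_pos, fun _ => ?_⟩
        filter_upwards [eventually_gt_atTop (M + v j)] with γ hγ a ha
        have h1 := hM a ha.1
        have h2 : γ ≤ inner ℝ (u j) a + v j := ha.2
        linarith
      · push Not at hbdd
        obtain ⟨w, hw, huw⟩ : ∃ w, (∀ x ∈ D j, ∀ s : ℝ, 0 ≤ s → x + s • w ∈ D j) ∧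
            0 < (inner ℝ (u j) w : ℝ) := by
          obtain ⟨n, c, β, hDj⟩ := hD j
          obtain ⟨w, hw, huw⟩ := exists_recession_direction n (fun i => innerₛₗ ℝ (c i)) β
            (innerₛₗ ℝ (u j)) fun M => by
              obtain ⟨x, hx, hxM⟩ := hbdd M
              rw [hDj] at hx
              exact ⟨x, hx, hxM⟩
          refine ⟨w, fun x hx s hs => ?_, huw⟩
          rw [hDj] at hx ⊢
          intro i
          have h1 : (inner ℝ (c i) w : ℝ) ≤ 0 := hw i
          have h2 := mul_nonpos_of_nonneg_of_nonpos hs h1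
          have h3 : (inner ℝ (c i) x : ℝ) ≤ β i := hx i
          rw [inner_add_right, real_inner_smul_right]
          linarith
        obtain ⟨κ, hκ, hκ2⟩ := le_lawOf_gaussianDensity_piece hS m (hD j).convex hint hw huw hε
        refine ⟨κ, hκ, fun _ => Eventually.of_forall fun γ a ha hq => ?_⟩
        refine (hκ2 a ha.1 hq).trans (measure_mono ?_)
        rintro x ⟨hx, hx2⟩
        have h2 : γ ≤ inner ℝ (u j) a + v j := ha.2
        have h3 : (inner ℝ (u j) a : ℝ) ≤ inner ℝ (u j) x := hx2
        exact ⟨hx, h2.trans (by gcongr)⟩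
    · exact ⟨1, one_pos, fun h => (hint h).elim⟩
  choose κ hκ hκ2 using hpiece
  obtain ⟨κ₀, hκ₀, hle⟩ : ∃ κ₀ : ℝ, 0 < κ₀ ∧ ∀ j, κ₀ ≤ κ j := by
    have h1 : ∀ᶠ t : ℝ in 𝓝[>] 0, ∀ j, t ∈ Ioc 0 (κ j) :=
      eventually_all.2 fun j => Ioc_mem_nhdsGT (hκ j)
    obtain ⟨t, ht, ht0⟩ := (h1.and self_mem_nhdsWithin).exists
    exact ⟨t, ht0, fun j => (ht j).2⟩
  refine ⟨κ₀, hκ₀, ?_⟩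
  have hall : ∀ᶠ γ in atTop, ∀ j, (interior (D j)).Nonempty →
      ∀ a ∈ levelPiece (D j) (u j) (v j) γ, 1 ≤ precForm S (a - m) (a - m) →
        ENNReal.ofReal (κ j * Real.exp (-(1 / 2) * ((1 + ε) * precForm S (a - m) (a - m)))) ≤
          lawOf (gaussianDensity m S) (levelPiece (D j) (u j) (v j) γ) := by
    refine eventually_all.2 fun j => ?_
    by_cases h : (interior (D j)).Nonempty
    · filter_upwards [hκ2 j h] with γ hγ _ using hγ
    · exact Eventually.of_forall fun γ h' => (h h').elim
  filter_upwards [hall] with γ hγ a ha hq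
  obtain ⟨j, haj, hint⟩ := exists_mem_with_interior (fun j => (hD j).isClosed) hcov a
  have hmem : a ∈ levelPiece (D j) (u j) (v j) γ := by
    refine ⟨haj, ?_⟩
    rw [mem_ofPred_eq, ← hg j a haj]
    exact ha
  refine ⟨j, hmem, le_trans (ENNReal.ofReal_le_ofReal ?_) (hγ j hint a hmem hq)⟩
  have := hle j
  gcongr

/-- The rare-event sets recede from the mean. -/
theorem eventually_le_precForm {S : Matrix (Fin d) (Fin d) ℝ} (hS : S.PosDef)
    (m : EuclideanSpace ℝ (Fin d)) {g : EuclideanSpace ℝ (Fin d) → ℝ} (hg : Continuous g) (M : ℝ) :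
    ∀ᶠ γ in atTop, ∀ x ∈ rareSet g γ, M ≤ precForm S (x - m) (x - m) := by
  obtain ⟨T, hT, -⟩ := exists_whitening hS
  obtain ⟨B, hB⟩ := (isCompact_closedBall (0 : EuclideanSpace ℝ (Fin d)) (√M)).bddAbove_image
    (f := fun y => g (T.symm y + m))
    (hg.comp (T.symm.continuous.add continuous_const)).continuousOn
  filter_upwards [eventually_gt_atTop B] with γ hγ x hx
  by_contra! hcon
  have hmem : T (x - m) ∈ Metric.closedBall (0 : EuclideanSpace ℝ (Fin d)) (√M) := by
    rw [mem_closedBall_zero_iff]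
    refine Real.le_sqrt_of_sq_le ?_
    rw [← real_inner_self_eq_norm_sq, ← hT]
    exact hcon.le
  have h1 := hB (mem_image_of_mem _ hmem)
  simp only [ContinuousLinearEquiv.symm_apply_apply, sub_add_cancel] at h1
  have h2 : γ ≤ g x := hx
  linarith

theorem tendsto_measure_rareSet {g : EuclideanSpace ℝ (Fin d) → ℝ} (hg : Continuous g)
    (P : Measure (EuclideanSpace ℝ (Fin d))) [IsFiniteMeasure P] :
    Tendsto (fun γ => P (rareSet g γ)) atTop (𝓝 0) := by
  have h := tendsto_measure_iInter_atTop (μ := P) (s := rareSet g)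
    (fun γ => (isClosed_le continuous_const hg).measurableSet.nullMeasurableSet)
    (fun γ γ' hγ x hx => le_trans hγ hx) ⟨0, measure_ne_top P _⟩
  have hemp : ⋂ γ, rareSet g γ = ∅ := by
    refine eq_empty_of_forall_notMem fun x hx => ?_
    have : g x + 1 ≤ g x := mem_iInter.1 hx (g x + 1)
    linarith
  rwa [hemp, measure_empty] at h

/-! ### Estimates for the original and the sampling distribution -/

theorem isClosed_halfSpace_gaussian {S : Matrix (Fin d) (Fin d) ℝ} (hS : S.PosDef)
    (m a : EuclideanSpace ℝ (Fin d)) :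
    IsClosed (halfSpace (lawOf (gaussianDensity m S)) a) := by
  have h : halfSpace (lawOf (gaussianDensity m S)) a = {x | 0 ≤ precForm S (a - m) (x - a)} :=
    Set.ext fun x => mem_halfSpace_gaussian_iff hS m a x
  rw [h]
  exact isClosed_le continuous_const
    (Continuous.precForm S continuous_const (continuous_id.sub continuous_const))

theorem measurableSet_coveredPart {S : Matrix (Fin d) (Fin d) ℝ} (hS : S.PosDef)
    (m : EuclideanSpace ℝ (Fin d)) {E : Set (EuclideanSpace ℝ (Fin d))} (hE : MeasurableSet E)
    (a : ℕ → EuclideanSpace ℝ (Fin d)) (k : ℕ) :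
    MeasurableSet (coveredPart (lawOf (gaussianDensity m S)) E a k) := by
  have h : coveredPart (lawOf (gaussianDensity m S)) E a k =
      E ∩ ⋃ i ∈ Iio k, halfSpace (lawOf (gaussianDensity m S)) (a i) := by
    ext x
    simp [coveredPart]
  rw [h]
  exact hE.inter (MeasurableSet.biUnion (to_countable _) fun i _ =>
    (isClosed_halfSpace_gaussian hS m (a i)).measurableSet)

theorem gaussianDensity_le_of_mem_halfSpace {S : Matrix (Fin d) (Fin d) ℝ} (hS : S.PosDef)
    {m a x : EuclideanSpace ℝ (Fin d)} (hx : 0 ≤ precForm S (a - m) (x - a)) :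
    gaussianDensity m S x ≤
      Real.exp (-(1 / 2) * precForm S (a - m) (a - m)) * gaussianDensity a S x := by
  have := (gaussianDensity_pos hS a x).le
  rw [gaussianDensity_tilt hS m a x]
  gcongr
  linarith

/-- Chernoff's bound for the half-space of `a`. -/
theorem lawOf_halfSpace_le {S : Matrix (Fin d) (Fin d) ℝ} (hS : S.PosDef)
    (m a : EuclideanSpace ℝ (Fin d)) :
    lawOf (gaussianDensity m S) (halfSpace (lawOf (gaussianDensity m S)) a) ≤
      ENNReal.ofReal (Real.exp (-(1 / 2) * precForm S (a - m) (a - m))) := by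
  set H := halfSpace (lawOf (gaussianDensity m S)) a with hH
  have hHm : MeasurableSet H := (isClosed_halfSpace_gaussian hS m a).measurableSet
  calc lawOf (gaussianDensity m S) H
      = ∫⁻ x in H, ENNReal.ofReal (gaussianDensity m S x) := withDensity_apply _ hHm
    _ ≤ ∫⁻ x in H, ENNReal.ofReal (Real.exp (-(1 / 2) * precForm S (a - m) (a - m))) *
          ENNReal.ofReal (gaussianDensity a S x) := by
        refine setLIntegral_mono ((measurable_ofReal_gaussianDensity a S).const_mul _)
          fun x hx => ?_
        rw [← ENNReal.ofReal_mul (by positivity)]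
        exact ENNReal.ofReal_le_ofReal (gaussianDensity_le_of_mem_halfSpace hS
          ((mem_halfSpace_gaussian_iff hS m a x).1 hx))
    _ ≤ ∫⁻ x, ENNReal.ofReal (Real.exp (-(1 / 2) * precForm S (a - m) (a - m))) *
          ENNReal.ofReal (gaussianDensity a S x) := setLIntegral_le_lintegral _ _
    _ = _ := by
        rw [lintegral_const_mul _ (measurable_ofReal_gaussianDensity a S),
          lintegral_gaussianDensity hS, mul_one]

theorem lawOf_le_of_subset_halfSpaces {S : Matrix (Fin d) (Fin d) ℝ} (hS : S.PosDef)
    (m : EuclideanSpace ℝ (Fin d)) {A : Set (EuclideanSpace ℝ (Fin d))}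
    {b : ℕ → EuclideanSpace ℝ (Fin d)} {r : ℕ} {Q : ℝ}
    (hA : ∀ x ∈ A, ∃ i < r, Q ≤ precForm S (b i - m) (b i - m) ∧
      0 ≤ precForm S (b i - m) (x - b i)) :
    lawOf (gaussianDensity m S) A ≤ ENNReal.ofReal (r * Real.exp (-(1 / 2) * Q)) := by
  classical
  set I := (Finset.range r).filter fun i => Q ≤ precForm S (b i - m) (b i - m) with hI
  have hsub : A ⊆ ⋃ i ∈ I, halfSpace (lawOf (gaussianDensity m S)) (b i) := by
    intro x hx
    obtain ⟨i, hi, hQ, h⟩ := hA x hx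
    exact mem_iUnion₂.2 ⟨i, Finset.mem_filter.2 ⟨Finset.mem_range.2 hi, hQ⟩,
      (mem_halfSpace_gaussian_iff hS m _ x).2 h⟩
  calc lawOf (gaussianDensity m S) A
      ≤ ∑ i ∈ I, lawOf (gaussianDensity m S) (halfSpace (lawOf (gaussianDensity m S)) (b i)) :=
        (measure_mono hsub).trans (measure_biUnion_finset_le _ _)
    _ ≤ ∑ _i ∈ I, ENNReal.ofReal (Real.exp (-(1 / 2) * Q)) := by
        refine Finset.sum_le_sum fun i hi => (lawOf_halfSpace_le hS m (b i)).trans ?_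
        have := (Finset.mem_filter.1 hi).2
        exact ENNReal.ofReal_le_ofReal (Real.exp_le_exp.2 (by linarith))
    _ ≤ (r : ℝ≥0∞) * ENNReal.ofReal (Real.exp (-(1 / 2) * Q)) := by
        rw [Finset.sum_const, nsmul_eq_mul]
        gcongr
        simpa using Finset.card_filter_le (Finset.range r) _
    _ = _ := by
        rw [ENNReal.ofReal_mul (by positivity), ENNReal.ofReal_natCast]

/-- Gaussian tail bound, by comparison with the density with covariance matrix `2Σ`. -/
theorem exists_gaussian_tail_bound {S : Matrix (Fin d) (Fin d) ℝ} (hS : S.PosDef) :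
    ∃ Λ : ℝ, 0 < Λ ∧ ∀ (a : EuclideanSpace ℝ (Fin d)) (A : Set (EuclideanSpace ℝ (Fin d))) (Q : ℝ),
      MeasurableSet A → (∀ x ∈ A, Q ≤ precForm S (x - a) (x - a)) →
      lawOf (gaussianDensity a S) A ≤ ENNReal.ofReal (Λ * Real.exp (-(1 / 4) * Q)) := by
  have hS2 : ((2 : ℝ) • S).PosDef := hS.smul two_pos
  have hu := (Matrix.isUnit_iff_isUnit_det _).1 hS.isUnit
  have hform : ∀ v, precForm ((2 : ℝ) • S) v v = 1 / 2 * precForm S v v := by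
    intro v
    have hinv : ((2 : ℝ) • S)⁻¹ = (1 / 2 : ℝ) • S⁻¹ := by
      refine Matrix.inv_eq_right_inv ?_
      rw [Matrix.smul_mul, Matrix.mul_smul, Matrix.mul_nonsing_inv _ hu, smul_smul]
      norm_num
    rw [precForm, precForm, hinv, Matrix.smul_mulVec, dotProduct_smul, smul_eq_mul]
  have hc1 := gaussianConst_pos hS
  have hc2 := gaussianConst_pos hS2
  refine ⟨gaussianConst S / gaussianConst ((2 : ℝ) • S), by positivity, fun a A Q hA hQ => ?_⟩
  set Λ := gaussianConst S / gaussianConst ((2 : ℝ) • S) with hΛ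
  calc lawOf (gaussianDensity a S) A
      = ∫⁻ x in A, ENNReal.ofReal (gaussianDensity a S x) := withDensity_apply _ hA
    _ ≤ ∫⁻ x in A, ENNReal.ofReal (Λ * Real.exp (-(1 / 4) * Q)) *
          ENNReal.ofReal (gaussianDensity a ((2 : ℝ) • S) x) := by
        refine setLIntegral_mono ((measurable_ofReal_gaussianDensity a _).const_mul _)
          fun x hx => ?_
        rw [← ENNReal.ofReal_mul (by positivity)]
        refine ENNReal.ofReal_le_ofReal ?_
        have h1 := hQ x hx
        have h2 : gaussianDensity a S x = Λ * Real.exp (-(1 / 4) * precForm S (x - a) (x - a)) *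
            gaussianDensity a ((2 : ℝ) • S) x := by
          rw [gaussianDensity_eq, gaussianDensity_eq, hform, hΛ]
          have h3 : -(1 / 2) * precForm S (x - a) (x - a) =
            -(1 / 4) * precForm S (x - a) (x - a) +
              -(1 / 2) * (1 / 2 * precForm S (x - a) (x - a)) := by ring
          rw [h3, Real.exp_add]
          field_simp
        have h4 := (gaussianDensity_pos hS2 a x).le
        rw [h2]
        refine mul_le_mul_of_nonneg_right (mul_le_mul_of_nonneg_left ?_ (by positivity)) h4
        exact Real.exp_le_exp.2 (by linarith)
    _ ≤ ∫⁻ x, ENNReal.ofReal (Λ * Real.exp (-(1 / 4) * Q)) *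
          ENNReal.ofReal (gaussianDensity a ((2 : ℝ) • S) x) := setLIntegral_le_lintegral _ _
    _ = _ := by
        rw [lintegral_const_mul _ (measurable_ofReal_gaussianDensity a _),
          lintegral_gaussianDensity hS2, mul_one]

/-- The law `N(a, Σ)` gives the ellipsoid about `m` through `a` a probability that is bounded
below: near `a` the ellipsoid contains a ball of fixed radius. -/
theorem exists_le_lawOf_ellipsoid {S : Matrix (Fin d) (Fin d) ℝ} (hS : S.PosDef) :
    ∃ κ : ℝ, 0 < κ ∧ ∀ m a : EuclideanSpace ℝ (Fin d), 1 ≤ precForm S (a - m) (a - m) →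
      ENNReal.ofReal κ ≤ lawOf (gaussianDensity a S)
        {x | precForm S (x - m) (x - m) < precForm S (a - m) (a - m)} := by
  obtain ⟨T, hT, -⟩ := exists_whitening hS
  set T' : EuclideanSpace ℝ (Fin d) →L[ℝ] EuclideanSpace ℝ (Fin d) :=
    T.toContinuousLinearMap with hT'
  have hr : 0 < (‖T'‖ + 1)⁻¹ := by positivity
  obtain ⟨κ, hκ, hκ2⟩ := le_lawOf_gaussianDensity_of_ball hS hr
  refine ⟨κ * Real.exp (-(1 / 2) * 4), by positivity, fun m a ha => ?_⟩
  have hq : ∀ v, precForm S v v = ‖T v‖ ^ 2 := fun v => by rw [hT, real_inner_self_eq_norm_sq]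
  simp only [hq] at ha ⊢
  set R := ‖T (a - m)‖ with hR
  have hR1 : 1 ≤ R := by
    by_contra! h
    have := pow_lt_one₀ (norm_nonneg (T (a - m))) h two_ne_zero
    linarith
  have hR0 : 0 < R := by linarith
  -- the centre of the ball is at unit distance from `a` in the whitened coordinates
  set c := a - R⁻¹ • (a - m) with hc
  have hball : ∀ z ∈ Metric.ball c (‖T'‖ + 1)⁻¹, ‖T (z - c)‖ < 1 := by
    intro z hz
    rw [Metric.mem_ball, dist_eq_norm] at hz
    calc ‖T (z - c)‖ ≤ ‖T'‖ * ‖z - c‖ := T'.le_opNorm _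
      _ ≤ ‖T'‖ * (‖T'‖ + 1)⁻¹ := by gcongr
      _ < 1 := by
        rw [← div_eq_mul_inv, div_lt_one (by positivity)]
        linarith
  refine hκ2 a c _ 4 (fun z hz => ?_) fun z hz => ?_
  · have h1 : z - m = (z - c) + (1 - R⁻¹) • (a - m) := by
      rw [hc, sub_smul, one_smul]; abel
    have h2 : ‖T (z - m)‖ < R := by
      calc ‖T (z - m)‖ ≤ ‖T (z - c)‖ + ‖(1 - R⁻¹) • T (a - m)‖ := by
            rw [h1, map_add, map_smul]
            exact norm_add_le _ _
        _ < 1 + (1 - R⁻¹) * R := by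
            have : 0 ≤ 1 - R⁻¹ := sub_nonneg.2 (inv_le_one_of_one_le₀ hR1)
            rw [norm_smul, Real.norm_of_nonneg this]
            exact add_lt_add_of_lt_of_le (hball z hz) le_rfl
        _ = R := by field_simp; ring
    exact pow_lt_pow_left₀ h2 (norm_nonneg _) two_ne_zero
  · have h1 : z - a = (z - c) - R⁻¹ • (a - m) := by
      rw [hc]; abel
    have h2 : ‖T (z - a)‖ ≤ 2 := by
      calc ‖T (z - a)‖ ≤ ‖T (z - c)‖ + ‖R⁻¹ • T (a - m)‖ := by
            rw [h1, map_sub, map_smul]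
            exact norm_sub_le _ _
        _ ≤ 1 + 1 := by
            refine add_le_add (hball z hz).le ?_
            rw [norm_smul, Real.norm_of_nonneg (by positivity), ← hR, inv_mul_cancel₀ hR0.ne']
        _ = 2 := by norm_num
    rw [hq]
    calc ‖T (z - a)‖ ^ 2 ≤ 2 ^ 2 := by gcongr
      _ = 4 := by norm_num

theorem continuous_isDensity {S : Matrix (Fin d) (Fin d) ℝ} (hS : S.PosDef)
    (m : EuclideanSpace ℝ (Fin d)) (b : ℕ → EuclideanSpace ℝ (Fin d)) (k : ℕ) :
    Continuous (isDensity (gaussianDensity m S) b k) := by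
  rw [funext (isDensity_gaussian hS m b k)]
  exact continuous_const.mul (continuous_finsetSum _ fun i _ => continuous_gaussianDensity _ _)

theorem isDensity_pos {S : Matrix (Fin d) (Fin d) ℝ} (hS : S.PosDef)
    (m : EuclideanSpace ℝ (Fin d)) (b : ℕ → EuclideanSpace ℝ (Fin d)) {k : ℕ} (hk : 1 ≤ k)
    (x : EuclideanSpace ℝ (Fin d)) : 0 < isDensity (gaussianDensity m S) b k x := by
  rw [isDensity_gaussian hS]
  have hk0 : (0 : ℝ) < k := by exact_mod_cast hk
  exact mul_pos (by positivity) (Finset.sum_pos (fun i _ => gaussianDensity_pos hS _ _)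
    ⟨0, Finset.mem_range.2 hk⟩)

/-- The sampling distribution is a uniform mixture of Gaussian laws. -/
theorem lawOf_isDensity_apply {S : Matrix (Fin d) (Fin d) ℝ} (hS : S.PosDef)
    (m : EuclideanSpace ℝ (Fin d)) (b : ℕ → EuclideanSpace ℝ (Fin d)) (k : ℕ)
    {A : Set (EuclideanSpace ℝ (Fin d))} (hA : MeasurableSet A) :
    lawOf (isDensity (gaussianDensity m S) b k) A =
      ENNReal.ofReal (1 / k) * ∑ i ∈ Finset.range k, lawOf (gaussianDensity (b i) S) A := by
  have h : ∀ x, ENNReal.ofReal (isDensity (gaussianDensity m S) b k x) =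
      ENNReal.ofReal (1 / k) *
        ∑ i ∈ Finset.range k, ENNReal.ofReal (gaussianDensity (b i) S x) := by
    intro x
    rw [isDensity_gaussian hS, ENNReal.ofReal_mul (by positivity),
      ENNReal.ofReal_sum_of_nonneg fun i _ => (gaussianDensity_pos hS _ _).le]
  rw [lawOf, withDensity_apply _ hA, lintegral_congr h,
    lintegral_const_mul _ (Finset.measurable_fun_sum _ fun i _ =>
      measurable_ofReal_gaussianDensity _ _),
    lintegral_finsetSum _ fun i _ => measurable_ofReal_gaussianDensity _ _]
  congr 1
  exact Finset.sum_congr rfl fun i _ => (withDensity_apply _ hA).symm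

theorem lawOf_isDensity_le {S : Matrix (Fin d) (Fin d) ℝ} (hS : S.PosDef)
    (m : EuclideanSpace ℝ (Fin d)) (b : ℕ → EuclideanSpace ℝ (Fin d)) {k : ℕ} (hk : 1 ≤ k)
    {A : Set (EuclideanSpace ℝ (Fin d))} (hA : MeasurableSet A) {δ : ℝ≥0∞}
    (h : ∀ i < k, lawOf (gaussianDensity (b i) S) A ≤ δ) :
    lawOf (isDensity (gaussianDensity m S) b k) A ≤ δ := by
  have hk0 : (0 : ℝ) < k := by exact_mod_cast hk
  rw [lawOf_isDensity_apply hS m b k hA]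
  calc ENNReal.ofReal (1 / k) * ∑ i ∈ Finset.range k, lawOf (gaussianDensity (b i) S) A
      ≤ ENNReal.ofReal (1 / k) * ∑ _i ∈ Finset.range k, δ := by
        gcongr with i hi
        exact h i (Finset.mem_range.1 hi)
    _ = (ENNReal.ofReal (1 / k) * ENNReal.ofReal k) * δ := by
        rw [Finset.sum_const, Finset.card_range, nsmul_eq_mul, ENNReal.ofReal_natCast, mul_assoc]
    _ = δ := by
        rw [← ENNReal.ofReal_mul (by positivity), one_div_mul_cancel hk0.ne', ENNReal.ofReal_one,
          one_mul]

theorem le_lawOf_isDensity {S : Matrix (Fin d) (Fin d) ℝ} (hS : S.PosDef)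
    (m : EuclideanSpace ℝ (Fin d)) (b : ℕ → EuclideanSpace ℝ (Fin d)) {k : ℕ} (hk : 1 ≤ k)
    {A : Set (EuclideanSpace ℝ (Fin d))} (hA : MeasurableSet A) :
    ENNReal.ofReal (1 / k) * lawOf (gaussianDensity (b 0) S) A ≤
      lawOf (isDensity (gaussianDensity m S) b k) A := by
  rw [lawOf_isDensity_apply hS m b k hA]
  gcongr
  exact Finset.single_le_sum (f := fun i => lawOf (gaussianDensity (b i) S) A)
    (fun i _ => zero_le) (Finset.mem_range.2 hk)

theorem isProbabilityMeasure_lawOf_isDensity {S : Matrix (Fin d) (Fin d) ℝ} (hS : S.PosDef)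
    (m : EuclideanSpace ℝ (Fin d)) (b : ℕ → EuclideanSpace ℝ (Fin d)) {k : ℕ} (hk : 1 ≤ k) :
    IsProbabilityMeasure (lawOf (isDensity (gaussianDensity m S) b k)) := by
  have hk0 : (0 : ℝ) < k := by exact_mod_cast hk
  have := isProbabilityMeasure_lawOf_gaussianDensity hS
  refine ⟨?_⟩
  rw [lawOf_isDensity_apply hS m b k MeasurableSet.univ]
  simp only [measure_univ, Finset.sum_const, Finset.card_range, nsmul_eq_mul, mul_one]
  rw [← ENNReal.ofReal_natCast, ← ENNReal.ofReal_mul (by positivity),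
    one_div_mul_cancel hk0.ne', ENNReal.ofReal_one]

/-- The variance of a random variable that vanishes outside `A` is at least the squared mean times
the probability of the complement of `A`. -/
theorem sq_mean_mul_le_variance {Ω : Type*} [MeasurableSpace Ω] {μ : Measure Ω}
    [IsProbabilityMeasure μ] {Z : Ω → ℝ} (hZ : MemLp Z 2 μ) {A : Set Ω} (hA : MeasurableSet A)
    (h0 : ∀ x ∉ A, Z x = 0) : (∫ x, Z x ∂μ) ^ 2 * μ.real Aᶜ ≤ variance Z μ := by
  rw [variance_eq_integral hZ.aestronglyMeasurable.aemeasurable]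
  have hint : Integrable (fun x => (Z x - ∫ x, Z x ∂μ) ^ 2) μ :=
    (hZ.sub (memLp_const (∫ x, Z x ∂μ))).integrable_sq
  calc (∫ x, Z x ∂μ) ^ 2 * μ.real Aᶜ = ∫ x in Aᶜ, (Z x - ∫ x, Z x ∂μ) ^ 2 ∂μ := by
        rw [setIntegral_congr_fun (g := fun _ => (∫ x, Z x ∂μ) ^ 2) hA.compl]
        · rw [setIntegral_const, smul_eq_mul, mul_comm]
        · intro x hx
          simp [h0 x hx]
    _ ≤ _ := setIntegral_le_integral hint (Eventually.of_forall fun x => sq_nonneg _)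

/-- The partial estimator is bounded and has mean `p₁` under the sampling distribution, so that
its variance is at least `p₁ ^ 2` times the probability of missing `𝓔₁`. -/
theorem le_variance_partialEstimator {S : Matrix (Fin d) (Fin d) ℝ} (hS : S.PosDef)
    (m : EuclideanSpace ℝ (Fin d)) {E : Set (EuclideanSpace ℝ (Fin d))} (hE : MeasurableSet E)
    (b : ℕ → EuclideanSpace ℝ (Fin d)) {k : ℕ} (hk : 1 ≤ k) :
    lawOf (gaussianDensity m S) (coveredPart (lawOf (gaussianDensity m S)) E b k) ^ 2 *
      lawOf (isDensity (gaussianDensity m S) b k)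
        (coveredPart (lawOf (gaussianDensity m S)) E b k)ᶜ ≤
      ENNReal.ofReal (variance (partialEstimator (gaussianDensity m S) E b k)
        (lawOf (isDensity (gaussianDensity m S) b k))) := by
  have hprob := isProbabilityMeasure_lawOf_isDensity hS m b hk
  have hprobm := isProbabilityMeasure_lawOf_gaussianDensity hS m
  set f := gaussianDensity m S with hf
  set A := coveredPart (lawOf f) E b k with hA
  set Pt := lawOf (isDensity f b k) with hPt
  set Z := partialEstimator f E b k with hZ
  have hAm : MeasurableSet A := measurableSet_coveredPart hS m hE b k
  have hfpos : ∀ x, 0 < f x := gaussianDensity_pos hS m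
  have htpos : ∀ x, 0 < isDensity f b k x := isDensity_pos hS m b hk
  have hk0 : (0 : ℝ) < k := by exact_mod_cast hk
  have hcont : Continuous fun x => f x / isDensity f b k x :=
    (continuous_gaussianDensity m S).div (continuous_isDensity hS m b k) fun x => (htpos x).ne'
  have hZm : Measurable Z := hcont.measurable.indicator hAm
  have hZ0 : ∀ x, 0 ≤ Z x := fun x =>
    indicator_nonneg (fun x _ => div_nonneg (hfpos x).le (htpos x).le) x
  -- on the half-space of `b i` the density `f` is at most that of `N(b i, Σ)`
  have hbound : ∀ x, ‖Z x‖ ≤ k := by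
    intro x
    rw [Real.norm_of_nonneg (hZ0 x)]
    refine indicator_apply_le' (fun hx => ?_) fun _ => hk0.le
    obtain ⟨-, i, hi, hxi⟩ := hx
    have h1 := gaussianDensity_le_of_mem_halfSpace hS
      ((mem_halfSpace_gaussian_iff hS m (b i) x).1 hxi)
    have h2 := precForm_self_nonneg hS (b i - m)
    have h3 : gaussianDensity m S x ≤ gaussianDensity (b i) S x := by
      refine h1.trans (mul_le_of_le_one_left (gaussianDensity_pos hS _ _).le ?_)
      exact Real.exp_le_one_iff.2 (by linarith)
    have h4 : gaussianDensity (b i) S x ≤ k * isDensity f b k x := by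
      rw [hf, isDensity_gaussian hS, ← mul_assoc, mul_one_div_cancel hk0.ne', one_mul]
      exact Finset.single_le_sum (f := fun i => gaussianDensity (b i) S x)
        (fun i _ => (gaussianDensity_pos hS _ _).le) (Finset.mem_range.2 hi)
    rw [div_le_iff₀ (htpos x)]
    exact h3.trans h4
  have hLp : MemLp Z 2 Pt :=
    MemLp.of_bound hZm.aestronglyMeasurable k (Eventually.of_forall hbound)
  have hmean : ∫ x, Z x ∂Pt = (lawOf f A).toReal := by
    rw [integral_eq_lintegral_of_nonneg_ae (Eventually.of_forall hZ0) hZm.aestronglyMeasurable]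
    congr 1
    rw [hPt, lawOf, lintegral_withDensity_eq_lintegral_mul _
      (continuous_isDensity hS m b k).measurable.ennreal_ofReal hZm.ennreal_ofReal, lawOf,
      withDensity_apply _ hAm, ← lintegral_indicator hAm]
    refine lintegral_congr fun x => ?_
    rw [Pi.mul_apply, ← ENNReal.ofReal_mul (htpos x).le]
    by_cases hx : x ∈ A
    · rw [indicator_of_mem hx, hZ, partialEstimator, indicator_of_mem hx,
        mul_div_cancel₀ _ (htpos x).ne']
    · rw [indicator_of_notMem hx, hZ, partialEstimator, indicator_of_notMem hx, mul_zero,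
        ENNReal.ofReal_zero]
  have hvar := sq_mean_mul_le_variance hLp hAm fun x hx => indicator_of_notMem hx _
  rw [hmean] at hvar
  refine le_trans (le_of_eq ?_) (ENNReal.ofReal_le_ofReal hvar)
  rw [ENNReal.ofReal_mul (by positivity), ENNReal.ofReal_pow ENNReal.toReal_nonneg,
    ENNReal.ofReal_toReal (measure_ne_top _ _), Measure.real,
    ENNReal.ofReal_toReal (measure_ne_top _ _)]

/-! ### Asymptotics -/

/-- What the asymptotic analysis uses of the points found by the search and their completion: for
`γ ≥ γ₀` they form a minimal ordered cover of bounded length, beginning with a point of the rare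
event set nearest to the mean, and if not all points are used, the quadratic form grows by more than
the factor `C` from the last point used to the next one. -/
structure IsSearchFamily (m : EuclideanSpace ℝ (Fin d)) (S : Matrix (Fin d) (Fin d) ℝ) (C : ℝ)
    (g : EuclideanSpace ℝ (Fin d) → ℝ) (γ₀ : ℝ) (R : ℕ) (k r : ℝ → ℕ)
    (b : ℝ → ℕ → EuclideanSpace ℝ (Fin d)) : Prop where
  one_le : ∀ γ, γ₀ ≤ γ → 1 ≤ k γ
  k_le : ∀ γ, γ₀ ≤ γ → k γ ≤ r γ
  r_le : ∀ γ, γ₀ ≤ γ → r γ ≤ R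
  cover : ∀ γ, γ₀ ≤ γ → IsOrderedCover m S (rareSet g γ) (b γ) (r γ)
  first : ∀ γ, γ₀ ≤ γ → ∀ x ∈ rareSet g γ,
    precForm S (b γ 0 - m) (b γ 0 - m) ≤ precForm S (x - m) (x - m)
  gap : ∀ γ, γ₀ ≤ γ → k γ < r γ → ∀ i < k γ,
    C * precForm S (b γ i - m) (b γ i - m) < precForm S (b γ (k γ) - m) (b γ (k γ) - m)

theorem exp_neg_rate_gaussian {S : Matrix (Fin d) (Fin d) ℝ} (hS : S.PosDef)
    (m a : EuclideanSpace ℝ (Fin d)) :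
    EReal.exp (-rate (lawOf (gaussianDensity m S)) a) =
      ENNReal.ofReal (Real.exp (-(1 / 2) * precForm S (a - m) (a - m))) := by
  rw [rate_gaussian hS, ← EReal.coe_neg, EReal.exp_coe, neg_mul]

theorem ofReal_exp_mul (x y : ℝ) : ENNReal.ofReal (Real.exp x) * ENNReal.ofReal (Real.exp y) =
    ENNReal.ofReal (Real.exp (x + y)) := by
  rw [← ENNReal.ofReal_mul (Real.exp_pos x).le, Real.exp_add]

namespace IsSearchFamily

variable {m : EuclideanSpace ℝ (Fin d)} {S : Matrix (Fin d) (Fin d) ℝ} {C : ℝ}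
  {g : EuclideanSpace ℝ (Fin d) → ℝ} {γ₀ : ℝ} {R : ℕ} {k r : ℝ → ℕ}
  {b : ℝ → ℕ → EuclideanSpace ℝ (Fin d)}

theorem r_pos (h : IsSearchFamily m S C g γ₀ R k r b) {γ : ℝ} (hγ : γ₀ ≤ γ) : 0 < r γ :=
  (h.one_le γ hγ).trans (h.k_le γ hγ)

theorem first_mem (h : IsSearchFamily m S C g γ₀ R k r b) {γ : ℝ} (hγ : γ₀ ≤ γ) :
    b γ 0 ∈ rareSet g γ :=
  (h.cover γ hγ).mem 0 (h.r_pos hγ)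

theorem r_le_real (h : IsSearchFamily m S C g γ₀ R k r b) {γ : ℝ} (hγ : γ₀ ≤ γ) :
    (r γ : ℝ) ≤ R := by
  exact_mod_cast h.r_le γ hγ

theorem R_pos (h : IsSearchFamily m S C g γ₀ R k r b) : (0 : ℝ) < R := by
  exact_mod_cast (h.r_pos le_rfl).trans_le (h.r_le γ₀ le_rfl)

/-- Points outside `𝓔₁` lie in the half-space of a point that was not used. -/
theorem exists_of_mem_missedPart (h : IsSearchFamily m S C g γ₀ R k r b) (hS : S.PosDef) {γ : ℝ}
    (hγ : γ₀ ≤ γ) {x : EuclideanSpace ℝ (Fin d)}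
    (hx : x ∈ missedPart (lawOf (gaussianDensity m S)) (rareSet g γ) (b γ) (k γ)) :
    (∃ j, k γ ≤ j ∧ j < r γ ∧ 0 ≤ precForm S (b γ j - m) (x - b γ j)) ∧
      ∀ i < k γ, precForm S (b γ i - m) (x - b γ i) < 0 := by
  have hlt : ∀ i < k γ, precForm S (b γ i - m) (x - b γ i) < 0 := by
    intro i hi
    by_contra! hcon
    exact hx.2 ⟨hx.1, i, hi, (mem_halfSpace_gaussian_iff hS m _ x).2 hcon⟩
  obtain ⟨j, hj, hj2⟩ := (h.cover γ hγ).cover x hx.1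
  refine ⟨⟨j, ?_, hj, hj2⟩, hlt⟩
  by_contra! hjk
  have := hlt j hjk
  linarith

theorem missedPart_eq_empty (h : IsSearchFamily m S C g γ₀ R k r b) (hS : S.PosDef) {γ : ℝ}
    (hγ : γ₀ ≤ γ) (hk : ¬ k γ < r γ) :
    missedPart (lawOf (gaussianDensity m S)) (rareSet g γ) (b γ) (k γ) = ∅ := by
  refine eq_empty_of_forall_notMem fun x hx => ?_
  obtain ⟨⟨j, hkj, hj, -⟩, -⟩ := h.exists_of_mem_missedPart hS hγ hx
  omega

theorem eventually_le_first (h : IsSearchFamily m S C g γ₀ R k r b) (hS : S.PosDef)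
    (hg : Continuous g) (M : ℝ) :
    ∀ᶠ γ in atTop, M ≤ precForm S (b γ 0 - m) (b γ 0 - m) := by
  filter_upwards [eventually_le_precForm hS m hg M, eventually_ge_atTop γ₀] with γ h1 hγ
  exact h1 _ (h.first_mem hγ)

/-- Upper bound for the probability of any part of the rare-event set. -/
theorem lawOf_le (h : IsSearchFamily m S C g γ₀ R k r b) (hS : S.PosDef) {γ : ℝ} (hγ : γ₀ ≤ γ)
    {A : Set (EuclideanSpace ℝ (Fin d))} (hA : A ⊆ rareSet g γ) :
    lawOf (gaussianDensity m S) A ≤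
      ENNReal.ofReal (R * Real.exp (-(1 / 2) * precForm S (b γ 0 - m) (b γ 0 - m))) := by
  refine (lawOf_le_of_subset_halfSpaces hS m (b := b γ) (r := r γ) fun x hx => ?_).trans
    (ENNReal.ofReal_le_ofReal (mul_le_mul_of_nonneg_right (h.r_le_real hγ) (Real.exp_pos _).le))
  obtain ⟨i, hi, hi2⟩ := (h.cover γ hγ).cover x (hA hx)
  exact ⟨i, hi, (h.cover γ hγ).sorted 0 i (Nat.zero_le i) hi, hi2⟩

/-- Lower bound for `p₁`: the convex piece of the rare-event set that contains the first point lies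
in the half-space of this point. -/
theorem eventually_le_lawOf_coveredPart (h : IsSearchFamily m S C g γ₀ R k r b) (hS : S.PosDef)
    (hg : IsPiecewiseLinear g) {ε : ℝ} (hε : 0 < ε) :
    ∀ᶠ γ in atTop, ENNReal.ofReal
        (Real.exp (-(1 / 2) * ((1 + ε) * precForm S (b γ 0 - m) (b γ 0 - m)))) ≤
      lawOf (gaussianDensity m S)
        (coveredPart (lawOf (gaussianDensity m S)) (rareSet g γ) (b γ) (k γ)) := by
  have hcont := hg.continuous
  obtain ⟨N, D, hD, hcov, hlin⟩ := hg
  choose u v hlin using hlin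
  obtain ⟨κ, hκ, hev⟩ := exists_piece_lower_bound hS m hD hcov hlin (half_pos hε)
  filter_upwards [hev, eventually_ge_atTop γ₀, h.eventually_le_first hS hcont 1,
    h.eventually_le_first hS hcont (-Real.log κ / (ε / 4))] with γ hγ1 hγ hq hq2
  obtain ⟨j, hj, hP⟩ := hγ1 _ (h.first_mem hγ) hq
  have hsub : levelPiece (D j) (u j) (v j) γ ⊆ rareSet g γ := by
    rw [rareSet_eq_iUnion hcov hlin γ]
    exact subset_iUnion (fun j => levelPiece (D j) (u j) (v j) γ) j
  refine le_trans (ENNReal.ofReal_le_ofReal ?_) (hP.trans (measure_mono fun x hx => ?_))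
  · rw [div_le_iff₀ (by positivity)] at hq2
    nth_rewrite 1 [← Real.exp_log hκ]
    rw [← Real.exp_add]
    refine Real.exp_le_exp.2 ?_
    linarith
  · refine ⟨hsub hx, 0, h.one_le γ hγ, (mem_halfSpace_gaussian_iff hS m _ x).2 ?_⟩
    exact precForm_nonneg_of_minimizer hS ((hD j).convex_levelPiece _ _ _) hj
      (fun y hy => h.first γ hγ y (hsub hy)) hx

theorem eventually_first_le_negLogP (h : IsSearchFamily m S C g γ₀ R k r b) (hS : S.PosDef)
    (hg : Continuous g)
    (hpos : ∀ γ, γ₀ ≤ γ → 0 < lawOf (gaussianDensity m S) (rareSet g γ)) :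
    ∀ᶠ γ in atTop, 1 / 4 * precForm S (b γ 0 - m) (b γ 0 - m) ≤
      negLogP (lawOf (gaussianDensity m S)) g γ := by
  have := isProbabilityMeasure_lawOf_gaussianDensity hS m
  have hR := h.R_pos
  filter_upwards [eventually_ge_atTop γ₀, h.eventually_le_first hS hg (4 * Real.log R)]
    with γ hγ hq
  have h1 := ENNReal.toReal_mono ENNReal.ofReal_ne_top (h.lawOf_le hS hγ Subset.rfl)
  rw [ENNReal.toReal_ofReal (by positivity)] at h1
  have h0 : 0 < (lawOf (gaussianDensity m S) (rareSet g γ)).toReal :=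
    ENNReal.toReal_pos (hpos γ hγ).ne' (measure_ne_top _ _)
  have h2 := Real.log_le_log h0 h1
  rw [Real.log_mul hR.ne' (Real.exp_pos _).ne', Real.log_exp] at h2
  rw [negLogP, Measure.real]
  linarith

theorem eventually_negLogP_le (h : IsSearchFamily m S C g γ₀ R k r b) (hS : S.PosDef)
    (hg : IsPiecewiseLinear g) :
    ∀ᶠ γ in atTop, negLogP (lawOf (gaussianDensity m S)) g γ ≤
      precForm S (b γ 0 - m) (b γ 0 - m) := by
  have := isProbabilityMeasure_lawOf_gaussianDensity hS m
  filter_upwards [h.eventually_le_lawOf_coveredPart hS hg one_pos] with γ hγ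
  have h1 := ENNReal.toReal_mono (measure_ne_top _ _)
    (hγ.trans (measure_mono fun x (hx : x ∈ coveredPart _ _ _ _) => hx.1))
  rw [ENNReal.toReal_ofReal (Real.exp_pos _).le] at h1
  have h2 := Real.log_le_log (Real.exp_pos _) h1
  rw [Real.log_exp] at h2
  rw [negLogP, Measure.real]
  linarith

theorem eventually_le_exp_negLogP (h : IsSearchFamily m S C g γ₀ R k r b) (hS : S.PosDef)
    (hg : Continuous g)
    (hpos : ∀ γ, γ₀ ≤ γ → 0 < lawOf (gaussianDensity m S) (rareSet g γ)) {ε : ℝ} (hε : 0 < ε)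
    (M : ℝ) :
    ∀ᶠ γ in atTop, M ≤ Real.exp (ε * negLogP (lawOf (gaussianDensity m S)) g γ) := by
  filter_upwards [h.eventually_first_le_negLogP hS hg hpos,
    h.eventually_le_first hS hg (4 * (M / ε))] with γ h1 h2
  have h3 : M / ε ≤ negLogP (lawOf (gaussianDensity m S)) g γ := by linarith
  rw [div_le_iff₀ hε] at h3
  have := Real.add_one_le_exp (ε * negLogP (lawOf (gaussianDensity m S)) g γ)
  linarith

theorem isDominatingSet (h : IsSearchFamily m S C g γ₀ R k r b) (hS : S.PosDef) {γ : ℝ}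
    (hγ : γ₀ ≤ γ) : IsDominatingSet (lawOf (gaussianDensity m S)) (rareSet g γ)
      (b γ '' Iio (r γ)) where
  subset := by
    rintro _ ⟨i, hi, rfl⟩
    exact (h.cover γ hγ).mem i hi
  tiltable := by
    intro y _
    refine ⟨by simp [effDomain_rate_gaussian hS], ?_⟩
    obtain ⟨s, hs⟩ := exists_covMap_eq hS (y - m)
    exact ⟨s, (isTilt_gaussian_iff hS m y s).2 hs⟩
  cover := by
    intro x hx
    obtain ⟨i, hi, hi2⟩ := (h.cover γ hγ).cover x hx
    exact ⟨b γ i, ⟨i, hi, rfl⟩, (mem_halfSpace_gaussian_iff hS m _ x).2 hi2⟩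
  minimal := by
    rintro _ ⟨i, hi, rfl⟩ hcon
    obtain ⟨x, hx, hx2⟩ := (h.cover γ hγ).minimal i hi
    obtain ⟨_, ⟨⟨j, hj, rfl⟩, hne⟩, hmem⟩ := hcon x hx
    have h1 := (mem_halfSpace_gaussian_iff hS m _ x).1 hmem
    have h2 := hx2 j hj fun hji => hne (by rw [hji]; rfl)
    linarith

theorem injOn (h : IsSearchFamily m S C g γ₀ R k r b) {γ : ℝ} (hγ : γ₀ ≤ γ) :
    InjOn (b γ) (Iio (r γ)) := by
  intro i hi j hj hij
  by_contra hne
  obtain ⟨x, hx, hx2⟩ := (h.cover γ hγ).minimal i hi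
  obtain ⟨l, hl, hl2⟩ := (h.cover γ hγ).cover x hx
  by_cases hli : l = i
  · have h1 := hx2 j hj fun h' => hne h'.symm
    rw [hli, hij] at hl2
    linarith
  · have := hx2 l hl hli
    linarith

theorem problemAssumption (h : IsSearchFamily m S C g γ₀ R k r b) (hS : S.PosDef)
    (hg : IsPiecewiseLinear g)
    (hpos : ∀ γ, γ₀ ≤ γ → 0 < lawOf (gaussianDensity m S) (rareSet g γ))
    (hmean : ∀ γ, γ₀ ≤ γ → m ∉ rareSet g γ) :
    ProblemAssumption (gaussianDensity m S) g γ₀ b r where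
  isProb := isProbabilityMeasure_lawOf_gaussianDensity hS m
  closed := hg.isClosed_rareSet
  rare :=
    have := isProbabilityMeasure_lawOf_gaussianDensity hS m
    tendsto_measure_rareSet hg.continuous _
  cumulant := cumulantAssumption_gaussian hS m
  inf_pos := by
    intro γ hγ
    have hne : b γ 0 - m ≠ 0 := by
      intro h0
      have := h.first_mem hγ
      rw [sub_eq_zero.1 h0] at this
      exact hmean γ hγ this
    have h1 : (0 : EReal) < ((1 / 2 * precForm S (b γ 0 - m) (b γ 0 - m) : ℝ) : EReal) := by
      have := precForm_self_pos hS hne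
      exact EReal.coe_pos.2 (by positivity)
    refine h1.trans_le (le_iInf₂ fun x hx => ?_)
    rw [rate_gaussian hS]
    have := h.first γ hγ x hx
    exact EReal.coe_le_coe_iff.2 (by linarith)
  inf_lt_top := by
    intro γ hγ
    refine (iInf₂_le (b γ 0) (h.first_mem hγ)).trans_lt ?_
    rw [rate_gaussian hS]
    exact EReal.coe_lt_top _
  dominating := fun γ hγ => h.isDominatingSet hS hγ
  distinct := fun γ hγ => h.injOn hγ
  sorted := by
    intro γ hγ i j hij hj
    rw [rate_gaussian hS, rate_gaussian hS]
    have := (h.cover γ hγ).sorted i j hij hj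
    exact EReal.coe_le_coe_iff.2 (by linarith)
  subexp := by
    intro ε hε
    filter_upwards [h.eventually_le_exp_negLogP hS hg.continuous hpos hε R,
      eventually_ge_atTop γ₀] with γ h1 hγ
    rw [one_mul, ← ENNReal.ofReal_natCast]
    exact ENNReal.ofReal_le_ofReal ((h.r_le_real hγ).trans h1)

theorem missedProbAssumption (h : IsSearchFamily m S C g γ₀ R k r b) (hS : S.PosDef)
    (hg : IsPiecewiseLinear g) (hC : 1 < C)
    (hpos : ∀ γ, γ₀ ≤ γ → 0 < lawOf (gaussianDensity m S) (rareSet g γ)) :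
    MissedProbAssumption (gaussianDensity m S) g b r k where
  p₁_equiv := by
    constructor
    · intro ε hε
      filter_upwards [h.eventually_le_exp_negLogP hS hg.continuous hpos hε R,
        eventually_ge_atTop γ₀] with γ h1 hγ
      refine (h.lawOf_le hS hγ fun x hx => hx.1).trans ?_
      rw [exp_neg_rate_gaussian hS, mul_comm (ENNReal.ofReal _),
        ← ENNReal.ofReal_mul (Real.exp_pos _).le]
      exact ENNReal.ofReal_le_ofReal (mul_le_mul_of_nonneg_right h1 (Real.exp_pos _).le)
    · intro ε hε
      filter_upwards [h.eventually_le_lawOf_coveredPart hS hg (half_pos hε),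
        h.eventually_first_le_negLogP hS hg.continuous hpos] with γ h1 h2
      rw [exp_neg_rate_gaussian hS]
      refine le_trans ?_ (mul_le_mul_left h1 _)
      rw [ofReal_exp_mul]
      refine ENNReal.ofReal_le_ofReal (Real.exp_le_exp.2 ?_)
      have := mul_le_mul_of_nonneg_left h2 hε.le
      linarith
  p₂_le := by
    intro ε hε
    filter_upwards [h.eventually_le_exp_negLogP hS hg.continuous hpos hε R,
      eventually_ge_atTop γ₀] with γ h1 hγ
    by_cases hk : k γ < r γ
    · rw [nextRate, if_pos hk, exp_neg_rate_gaussian hS]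
      refine (lawOf_le_of_subset_halfSpaces hS m (b := b γ) (r := r γ)
        (Q := precForm S (b γ (k γ) - m) (b γ (k γ) - m)) fun x hx => ?_).trans ?_
      · obtain ⟨⟨j, hkj, hj, hj2⟩, -⟩ := h.exists_of_mem_missedPart hS hγ hx
        exact ⟨j, hj, (h.cover γ hγ).sorted _ j hkj hj, hj2⟩
      · rw [mul_comm (ENNReal.ofReal _), ← ENNReal.ofReal_mul (Real.exp_pos _).le]
        exact ENNReal.ofReal_le_ofReal
          (mul_le_mul_of_nonneg_right ((h.r_le_real hγ).trans h1) (Real.exp_pos _).le)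
    · rw [h.missedPart_eq_empty hS hγ hk, measure_empty]
      exact zero_le
  gap := by
    refine ⟨(C - 1) / 2, by linarith, ?_⟩
    filter_upwards [h.eventually_negLogP_le hS hg, eventually_ge_atTop γ₀] with γ h1 hγ
    by_cases hk : k γ < r γ
    · rw [nextRate, if_pos hk, rate_gaussian hS, rate_gaussian hS, ← EReal.coe_sub, EReal.exp_coe]
      refine ENNReal.ofReal_le_ofReal (Real.exp_le_exp.2 ?_)
      have h2 := h.gap γ hγ hk 0 (h.one_le γ hγ)
      have h3 := mul_le_mul_of_nonneg_left h1 (sub_pos.2 hC).le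
      linarith
    · rw [nextRate, if_neg hk, rate_gaussian hS, EReal.sub_top, EReal.exp_bot]
      exact zero_le

/-- On `𝓔₂` the quadratic form about each of the points used is at least `C - 1` times its value
for the first point about the mean, so that `𝓔₂` lies in the tails of the mixture components. -/
theorem missedSamplingAssumption (h : IsSearchFamily m S C g γ₀ R k r b) (hS : S.PosDef)
    (hg : IsPiecewiseLinear g) (hC : 1 < C) :
    MissedSamplingAssumption (gaussianDensity m S) g b k := by
  obtain ⟨Λ, hΛ, htail⟩ := exists_gaussian_tail_bound hS
  have hC1 : 0 < C - 1 := by linarith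
  refine ⟨(C - 1) / 8, by linarith, ?_⟩
  filter_upwards [h.eventually_negLogP_le hS hg, eventually_ge_atTop γ₀,
    h.eventually_le_first hS hg.continuous (Real.log Λ / ((C - 1) / 8))] with γ h1 hγ h2
  by_cases hk : k γ < r γ
  · have hEm : MeasurableSet (rareSet g γ) := (hg.isClosed_rareSet γ).measurableSet
    have hm : MeasurableSet
        (missedPart (lawOf (gaussianDensity m S)) (rareSet g γ) (b γ) (k γ)) :=
      hEm.diff (measurableSet_coveredPart hS m hEm _ _)
    refine lawOf_isDensity_le hS m (b γ) (h.one_le γ hγ) hm fun i hi => ?_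
    refine (htail (b γ i) _ ((C - 1) * precForm S (b γ 0 - m) (b γ 0 - m)) hm
      fun x hx => ?_).trans ?_
    · obtain ⟨⟨j, hkj, hj, hj2⟩, hlt⟩ := h.exists_of_mem_missedPart hS hγ hx
      have e1 := precForm_shift hS m (b γ i) x
      have e2 := precForm_shift hS m (b γ j) x
      have e3 := precForm_self_nonneg hS (x - b γ j)
      have e4 := (h.cover γ hγ).sorted _ j hkj hj
      have e5 := h.gap γ hγ hk i hi
      have e6 := hlt i hi
      have e7 := mul_le_mul_of_nonneg_left
        ((h.cover γ hγ).sorted 0 i (Nat.zero_le i) (hi.trans hk)) hC1.le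
      linarith
    · refine ENNReal.ofReal_le_ofReal ?_
      rw [div_le_iff₀ (by positivity)] at h2
      rw [← Real.exp_log hΛ, ← Real.exp_add]
      refine Real.exp_le_exp.2 ?_
      have := mul_le_mul_of_nonneg_left h1 hC1.le
      linarith
  · rw [h.missedPart_eq_empty hS hγ hk, measure_empty]
    exact zero_le

/-- The ellipsoid through the first point is disjoint from all half-spaces of the points used. -/
theorem ellipsoid_subset_compl_coveredPart (h : IsSearchFamily m S C g γ₀ R k r b)
    {γ : ℝ} (hγ : γ₀ ≤ γ) :
    {x | precForm S (x - m) (x - m) < precForm S (b γ 0 - m) (b γ 0 - m)} ⊆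
      (coveredPart (lawOf (gaussianDensity m S)) (rareSet g γ) (b γ) (k γ))ᶜ :=
  fun _ hx hcov => absurd (h.first γ hγ _ hcov.1) (not_le.2 hx)

theorem varianceAssumption (h : IsSearchFamily m S C g γ₀ R k r b) (hS : S.PosDef)
    (hg : IsPiecewiseLinear g)
    (hpos : ∀ γ, γ₀ ≤ γ → 0 < lawOf (gaussianDensity m S) (rareSet g γ)) :
    VarianceAssumption (gaussianDensity m S) g b k := by
  obtain ⟨κ, hκ, hell⟩ := exists_le_lawOf_ellipsoid hS
  intro ε hε
  have hR := h.R_pos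
  have hε8 : 0 < ε / 8 := by positivity
  filter_upwards [h.eventually_le_lawOf_coveredPart hS hg hε8,
    h.eventually_first_le_negLogP hS hg.continuous hpos, eventually_ge_atTop γ₀,
    h.eventually_le_first hS hg.continuous 1,
    h.eventually_le_exp_negLogP hS hg.continuous hpos (half_pos hε) (R / κ)] with γ h1 h2 hγ hq h3
  have hEm : MeasurableSet (rareSet g γ) := (hg.isClosed_rareSet γ).measurableSet
  have hAm := measurableSet_coveredPart hS m hEm (b γ) (k γ)
  have hk := h.one_le γ hγ
  have hk0 : (0 : ℝ) < k γ := by exact_mod_cast hk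
  have hkR : (k γ : ℝ) ≤ R := le_trans (by exact_mod_cast h.k_le γ hγ) (h.r_le_real hγ)
  have hPt : ENNReal.ofReal (κ / R) ≤ lawOf (isDensity (gaussianDensity m S) (b γ) (k γ))
      (coveredPart (lawOf (gaussianDensity m S)) (rareSet g γ) (b γ) (k γ))ᶜ := by
    refine le_trans ?_ (le_lawOf_isDensity hS m (b γ) hk hAm.compl)
    calc ENNReal.ofReal (κ / R) ≤ ENNReal.ofReal (1 / k γ * κ) := by
          refine ENNReal.ofReal_le_ofReal ?_
          rw [one_div_mul_eq_div]
          gcongr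
      _ = ENNReal.ofReal (1 / k γ) * ENNReal.ofReal κ := ENNReal.ofReal_mul (by positivity)
      _ ≤ _ := by
          gcongr
          exact (hell m (b γ 0) hq).trans
            (measure_mono (h.ellipsoid_subset_compl_coveredPart hγ))
  have hvar := le_variance_partialEstimator hS m hEm (b γ) hk
  rw [exp_neg_rate_gaussian hS]
  set Q := precForm S (b γ 0 - m) (b γ 0 - m) with hQ
  set l := negLogP (lawOf (gaussianDensity m S)) g γ with hl
  calc ENNReal.ofReal (Real.exp (-(1 / 2) * Q)) ^ 2
      = ENNReal.ofReal (Real.exp (-(1 / 2) * Q) ^ 2) :=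
        (ENNReal.ofReal_pow (Real.exp_pos _).le 2).symm
    _ ≤ ENNReal.ofReal (Real.exp (-(1 / 2) * ((1 + ε / 8) * Q)) ^ 2 * (κ / R) *
          Real.exp (ε * l)) := by
        refine ENNReal.ofReal_le_ofReal ?_
        have e1 : 1 ≤ κ / R * Real.exp (ε / 2 * l) := by
          rw [div_le_iff₀ hκ] at h3
          rw [div_mul_eq_mul_div, le_div_iff₀ hR]
          linarith
        have e2 : ε * (1 / 4 * Q) ≤ ε * l := mul_le_mul_of_nonneg_left h2 hε.le
        calc Real.exp (-(1 / 2) * Q) ^ 2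
            ≤ Real.exp (-(1 / 2) * ((1 + ε / 8) * Q)) ^ 2 * Real.exp (ε / 2 * l) := by
              rw [← Real.exp_nat_mul, ← Real.exp_nat_mul, ← Real.exp_add]
              refine Real.exp_le_exp.2 ?_
              push_cast
              linarith
          _ ≤ Real.exp (-(1 / 2) * ((1 + ε / 8) * Q)) ^ 2 * Real.exp (ε / 2 * l) *
                (κ / R * Real.exp (ε / 2 * l)) := le_mul_of_one_le_right (by positivity) e1
          _ = _ := by
              have : Real.exp (ε * l) = Real.exp (ε / 2 * l) * Real.exp (ε / 2 * l) := by
                rw [← Real.exp_add]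
                congr 1
                ring
              rw [this]
              ring
    _ = ENNReal.ofReal (Real.exp (-(1 / 2) * ((1 + ε / 8) * Q))) ^ 2 * ENNReal.ofReal (κ / R) *
          ENNReal.ofReal (Real.exp (ε * l)) := by
        rw [ENNReal.ofReal_mul (by positivity), ENNReal.ofReal_mul (by positivity),
          ENNReal.ofReal_pow (Real.exp_pos _).le]
    _ ≤ _ := by
        refine mul_le_mul_left (le_trans ?_ hvar) _
        gcongr

end IsSearchFamily

/-- The outcomes of the stopped searches at all levels can be completed to minimal ordered covers
whose length is bounded by a constant. -/
theorem exists_search_family {m : EuclideanSpace ℝ (Fin d)} {S : Matrix (Fin d) (Fin d) ℝ}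
    (hS : S.PosDef) {g : EuclideanSpace ℝ (Fin d) → ℝ} (hg : IsPiecewiseLinear g) {C : ℝ}
    (hC : 1 < C) {γ₀ : ℝ} (hne : ∀ γ, γ₀ ≤ γ → (rareSet g γ).Nonempty)
    {a : ℝ → ℕ → EuclideanSpace ℝ (Fin d)}
    (ha : ∀ γ, γ₀ ≤ γ → IsStoppedSearch m S C (rareSet g γ) (a γ)) :
    ∃ (R : ℕ) (k r : ℝ → ℕ) (b : ℝ → ℕ → EuclideanSpace ℝ (Fin d)),
      IsSearchFamily m S C g γ₀ R k r b ∧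
      ∀ γ, γ₀ ≤ γ → StopsAt m S C (rareSet g γ) (a γ) (k γ) ∧
        (∀ i, i ≤ k γ → i < r γ → b γ i = a γ i) ∧
        (IsFullSearch m S (rareSet g γ) (a γ) → ∀ i, i < r γ → b γ i = a γ i) := by
  obtain ⟨N, D, hD, hcov, hlin⟩ := hg
  choose u v hlin using hlin
  have hex : ∀ γ, ∃ (k r : ℕ) (b : ℕ → EuclideanSpace ℝ (Fin d)), γ₀ ≤ γ →
      StopsAt m S C (rareSet g γ) (a γ) k ∧ 1 ≤ k ∧ k ≤ r ∧ (∀ i, i ≤ k → i < r → b i = a γ i) ∧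
      (IsFullSearch m S (rareSet g γ) (a γ) → ∀ i, i < r → b i = a γ i) ∧
      r ≤ 2 * N ∧ IsOrderedCover m S (rareSet g γ) b r ∧ (k < r → BreaksAt m S C (a γ) k) ∧
      ∀ j < k, IsNextPoint m S (rareSet g γ) (a γ) j := by
    intro γ
    by_cases hγ : γ₀ ≤ γ
    · obtain ⟨k, r, b, h⟩ := exists_stop_and_cover hS
        (fun j => (hD j).convex_levelPiece (u j) (v j) γ)
        (fun j => (hD j).isClosed_levelPiece (u j) (v j) γ)
        (rareSet_eq_iUnion hcov hlin γ) (hne γ hγ) (ha γ hγ)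
      exact ⟨k, r, b, fun _ => h⟩
    · exact ⟨0, 0, 0, fun h => (hγ h).elim⟩
  choose k r b h using hex
  refine ⟨2 * N, k, r, b, ⟨fun γ hγ => (h γ hγ).2.1, fun γ hγ => (h γ hγ).2.2.1,
    fun γ hγ => (h γ hγ).2.2.2.2.2.1, fun γ hγ => (h γ hγ).2.2.2.2.2.2.1, ?_, ?_⟩,
    fun γ hγ => ⟨(h γ hγ).1, (h γ hγ).2.2.2.1, (h γ hγ).2.2.2.2.1⟩⟩
  · intro γ hγ x hx
    obtain ⟨-, hk, hkr, hb, -, -, -, -, hnext⟩ := h γ hγ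
    rw [hb 0 (Nat.zero_le _) (by omega)]
    exact (hnext 0 hk).2 x ⟨hx, fun i hi => (Nat.not_lt_zero i hi).elim⟩
  · intro γ hγ hkr i hi
    obtain ⟨-, hk, -, hb, -, -, hcover, hbreak, -⟩ := h γ hγ
    have h1 := (hbreak hkr).2
    rw [← hb (k γ) le_rfl hkr, ← hb (k γ - 1) (Nat.sub_le _ _) (by omega)] at h1
    have h2 := mul_le_mul_of_nonneg_left (hcover.sorted i (k γ - 1) (by omega) (by omega))
      (by linarith : (0 : ℝ) ≤ C)
    linarith

end RareEvent

theorem mainTheorem3 {d : ℕ} (m : EuclideanSpace ℝ (Fin d)) (S : Matrix (Fin d) (Fin d) ℝ)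
    (hS : S.PosDef) (g : EuclideanSpace ℝ (Fin d) → ℝ) (hg : RareEvent.IsPiecewiseLinear g)
    (C : ℝ) (hC : 1 < C) (γ₀ : ℝ)
    (hpos : ∀ γ, γ₀ ≤ γ →
      0 < RareEvent.lawOf (RareEvent.gaussianDensity m S) (RareEvent.rareSet g γ))
    (hmean : ∀ γ, γ₀ ≤ γ → m ∉ RareEvent.rareSet g γ)
    (a : ℝ → ℕ → EuclideanSpace ℝ (Fin d))
    (ha : ∀ γ, γ₀ ≤ γ → RareEvent.IsStoppedSearch m S C (RareEvent.rareSet g γ) (a γ)) :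
    ∃ (k r : ℝ → ℕ) (b : ℝ → ℕ → EuclideanSpace ℝ (Fin d)),
      (∀ γ, γ₀ ≤ γ →
        RareEvent.StopsAt m S C (RareEvent.rareSet g γ) (a γ) (k γ) ∧
        1 ≤ k γ ∧ k γ ≤ r γ ∧
        (∀ i, i ≤ k γ → i < r γ → b γ i = a γ i) ∧
        (RareEvent.IsFullSearch m S (RareEvent.rareSet g γ) (a γ) →
          ∀ i, i < r γ → b γ i = a γ i) ∧
        (∀ x, RareEvent.isDensity (RareEvent.gaussianDensity m S) (b γ) (k γ) x =
          (1 / (k γ : ℝ)) * ∑ i ∈ Finset.range (k γ), RareEvent.gaussianDensity (a γ i) S x) ∧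
        RareEvent.coveredPart (RareEvent.lawOf (RareEvent.gaussianDensity m S))
            (RareEvent.rareSet g γ) (b γ) (k γ) =
          RareEvent.rareSet g γ ∩
            ⋃ i < k γ, {x | 0 ≤ RareEvent.precForm S (a γ i - m) (x - a γ i)}) ∧
      RareEvent.ProblemAssumption (RareEvent.gaussianDensity m S) g γ₀ b r ∧
      RareEvent.MissedProbAssumption (RareEvent.gaussianDensity m S) g b r k ∧
      RareEvent.MissedSamplingAssumption (RareEvent.gaussianDensity m S) g b k ∧
      RareEvent.VarianceAssumption (RareEvent.gaussianDensity m S) g b k := by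
  obtain ⟨R, k, r, b, h, hb⟩ := RareEvent.exists_search_family hS hg hC
    (fun γ hγ => nonempty_of_measure_ne_zero (hpos γ hγ).ne') ha
  refine ⟨k, r, b, fun γ hγ => ?_, h.problemAssumption hS hg hpos hmean,
    h.missedProbAssumption hS hg hC hpos, h.missedSamplingAssumption hS hg hC,
    h.varianceAssumption hS hg hpos⟩
  obtain ⟨hend, hba, hfull⟩ := hb γ hγ
  have hkr := h.k_le γ hγ
  have hba' : ∀ i < k γ, b γ i = a γ i := fun i hi => hba i hi.le (hi.trans_le hkr)
  refine ⟨hend, h.one_le γ hγ, hkr, hba, hfull, fun x => ?_, ?_⟩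
  · rw [RareEvent.isDensity_gaussian hS]
    congr 1
    exact Finset.sum_congr rfl fun i hi => by rw [hba' i (Finset.mem_range.1 hi)]
  · ext x
    simp only [RareEvent.coveredPart, mem_ofPred_eq, mem_inter_iff, mem_iUnion, exists_prop]
    refine and_congr_right fun _ => exists_congr fun i => and_congr_right fun hi => ?_
    rw [RareEvent.mem_halfSpace_gaussian_iff hS, hba' i hi]
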